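/- Let $n\ge 3$, let $\mu_1,\dots,\mu_n\in\mathbb{C}$ with $0<|\mu_i|<1$ for all $i$, let $f(z_1,\dots,z_n)=(\mu_1z_1,\dots,\mu_nz_n)$, and let $X=(\mathbb{C}^n\setminus\{0\})/\langle f\rangle$ be the associated Hopf manifold. For $S\subseteq\{1,\dots,n\}$ say that the $\mu_i$, $i\in S$, satisfy no nontrivial relation if, whenever $S=A\sqcup B$ and $r_i\in\mathbb{N}=\{0,1,2,\dots\}$ satisfy $\prod_{i\in A}\mu_i^{r_i}=\prod_{j\in B}\mu_j^{r_j}$, all $r_i$ $(i\in S)$ are $0$. Call $X$ generic if $|\mu_1|\le\dots\le|\mu_n|$ and $\mu_1,\dots,\mu_n$ satisfy no nontrivial relation; call $X$ intermediary if for some $r$ with $2\le r\le n-1$ one has $\mu_1=\dots=\mu_r$ and $\mu_1,\mu_{r+1},\dots,\mu_n$ satisfy no nontrivial relation. A nonsingular codimension-one holomorphic distribution on $X$ is a holomorphic vector subbundle $D\subset TX$ of rank $n-1$. It is integrable if $[D,D]\subseteq D$, i.e. for any two holomorphic vector fields $V,W$ on an open set $U\subseteq X$ that are tangent to $D$, the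 Lie bracket $[V,W]$ is tangent to $D$ on $U$. If $X$ is generic or intermediary, then every nonsingular codimension-one holomorphic distribution on $X$ is integrable. -/

import Mathlib

open Set Filter Topology Manifold
open scoped ContDiff

/-! ### Diagonal contractions and Hopf manifolds -/

/-- The data of a diagonal linear contraction `f(z) = (μ₁ z₁, …, μₙ zₙ)` of `ℂⁿ`,
`0 < |μᵢ| < 1`. -/
structure DiagonalContraction (n : ℕ) where
  /-- the multipliers `μ₁, …, μₙ` (indexed from `0`) -/
  mult : Fin n → ℂ
  norm_pos : ∀ i, 0 < ‖mult i‖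
  norm_lt_one : ∀ i, ‖mult i‖ < 1

/-- There is no nontrivial relation `∏_{i ∈ A} μᵢ ^ rᵢ = ∏_{j ∈ B} μⱼ ^ rⱼ` with natural
exponents and `S` the disjoint union of `A` and `B`. -/
def HasNoRelation {n : ℕ} (μ : Fin n → ℂ) (S : Finset (Fin n)) : Prop :=
  ∀ (A B : Finset (Fin n)) (r : Fin n → ℕ), Disjoint A B → A ∪ B = S →
    ∏ i ∈ A, μ i ^ r i = ∏ j ∈ B, μ j ^ r j → ∀ i ∈ S, r i = 0

/-- The punctured space `W = ℂⁿ \ {0}`. -/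
abbrev PuncturedSpace (n : ℕ) : Type := {z : Fin n → ℂ // z ≠ 0}

namespace DiagonalContraction

variable {n : ℕ} (f : DiagonalContraction n)

/-- Generic multipliers: ordered by modulus and without nontrivial relation. -/
def IsGeneric : Prop :=
  Monotone (fun i => ‖f.mult i‖) ∧ HasNoRelation f.mult Finset.univ

/-- Intermediary multipliers: `μ₁ = ⋯ = μᵣ` for some `2 ≤ r ≤ n - 1`, and there is no nontrivial
relation between `μ₁, μᵣ₊₁, …, μₙ`. -/
def IsIntermediary : Prop :=
  ∃ r : ℕ, 2 ≤ r ∧ r + 1 ≤ n ∧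
    (∀ i j : Fin n, i.val < r → j.val < r → f.mult i = f.mult j) ∧
    HasNoRelation f.mult (Finset.univ.filter fun i : Fin n => i.val = 0 ∨ r ≤ i.val)

lemma mult_ne_zero (i : Fin n) : f.mult i ≠ 0 := norm_pos_iff.mp (f.norm_pos i)

/-- The iterate `f^k`, `k ∈ ℤ`, on `ℂⁿ`. -/
noncomputable def iter (k : ℤ) (z : Fin n → ℂ) : Fin n → ℂ := fun i => f.mult i ^ k * z i

lemma iter_zero (z : Fin n → ℂ) : f.iter 0 z = z := by
  funext i; simp [iter]

lemma iter_add (k l : ℤ) (z : Fin n → ℂ) : f.iter (k + l) z = f.iter k (f.iter l z) := by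
  funext i; simp [iter, zpow_add₀ (f.mult_ne_zero i), mul_assoc]

lemma iter_neg_iter (k : ℤ) (z : Fin n → ℂ) : f.iter (-k) (f.iter k z) = z := by
  rw [← iter_add, neg_add_cancel, iter_zero]

lemma contDiff_iter (k : ℤ) : ContDiff ℂ ω (f.iter k) := by
  unfold iter
  fun_prop

lemma iter_ne_zero (k : ℤ) {z : Fin n → ℂ} (hz : z ≠ 0) : f.iter k z ≠ 0 := by
  intro h
  apply hz
  rw [← f.iter_neg_iter k z, h]
  funext i; simp [iter]

/-- Two points of `W` are equivalent if they lie in one orbit of the group `⟨f⟩`. -/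
def orbitSetoid : Setoid (PuncturedSpace n) where
  r z w := ∃ k : ℤ, w.1 = f.iter k z.1
  iseqv :=
    { refl := fun z => ⟨0, (f.iter_zero _).symm⟩
      symm := by
        rintro z w ⟨k, h⟩
        exact ⟨-k, by rw [h, iter_neg_iter]⟩
      trans := by
        rintro z w u ⟨k, h⟩ ⟨l, h'⟩
        exact ⟨l + k, by rw [h', h, iter_add]⟩ }

end DiagonalContraction

/-- The Hopf manifold `X = (ℂⁿ \ {0}) / ⟨f⟩`, with the quotient topology. -/
def HopfManifold {n : ℕ} (f : DiagonalContraction n) : Type := Quotient f.orbitSetoid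

namespace HopfManifold

variable {n : ℕ} (f : DiagonalContraction n)

instance : TopologicalSpace (HopfManifold f) :=
  inferInstanceAs (TopologicalSpace (Quotient f.orbitSetoid))

/-- The projection `π : W → X`. -/
def proj (z : PuncturedSpace n) : HopfManifold f := Quotient.mk f.orbitSetoid z

lemma proj_eq_iff {z w : PuncturedSpace n} :
    proj f z = proj f w ↔ ∃ k : ℤ, w.1 = f.iter k z.1 := Quotient.eq (r := f.orbitSetoid)

lemma proj_surjective : Function.Surjective (proj f) := Quotient.mk_surjective

lemma continuous_proj : Continuous (proj f) := continuous_quotient_mk'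

lemma isOpenMap_proj : IsOpenMap (proj f) := by
  intro U hU
  have hq : IsQuotientMap (proj f) := isQuotientMap_quotient_mk'
  rw [← hq.isOpen_preimage]
  have : proj f ⁻¹' (proj f '' U) =
      ⋃ k : ℤ, (fun z : PuncturedSpace n =>
        (⟨f.iter k z.1, f.iter_ne_zero k z.2⟩ : PuncturedSpace n)) ⁻¹' U := by
    ext z
    simp only [mem_preimage, mem_image, mem_iUnion]
    constructor
    · rintro ⟨w, hw, h⟩
      obtain ⟨k, hk⟩ := (proj_eq_iff f).1 h.symm
      refine ⟨k, ?_⟩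
      have : (⟨f.iter k z.1, f.iter_ne_zero k z.2⟩ : PuncturedSpace n) = w := Subtype.ext hk.symm
      rwa [this]
    · rintro ⟨k, hk⟩
      exact ⟨_, hk, ((proj_eq_iff f).2 ⟨k, rfl⟩).symm⟩
  rw [this]
  refine isOpen_iUnion fun k => hU.preimage ?_
  exact Continuous.subtype_mk ((f.contDiff_iter k).continuous.comp continuous_subtype_val) _

/-- The open set `{z | a < |zᵢ| < a / |μᵢ|}` of `ℂⁿ`, on which `π` is injective. -/
def annulus (i : Fin n) (a : ℝ) : Set (Fin n → ℂ) :=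
  {z | a < ‖z i‖ ∧ ‖f.mult i‖ * ‖z i‖ < a}

lemma isOpen_annulus (i : Fin n) (a : ℝ) : IsOpen (annulus f i a) :=
  IsOpen.inter
    (isOpen_lt (f := fun _ : Fin n → ℂ => a) (g := fun z => ‖z i‖) (by fun_prop) (by fun_prop))
    (isOpen_lt (f := fun z : Fin n → ℂ => ‖f.mult i‖ * ‖z i‖) (g := fun _ => a)
      (by fun_prop) (by fun_prop))

lemma annulus_nonempty (i : Fin n) {a : ℝ} (ha : 0 < a) : Nonempty (annulus f i a) := by
  have h0 := f.norm_pos i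
  have h1 := f.norm_lt_one i
  obtain ⟨b, hb, hb'⟩ := exists_between ((lt_div_iff₀ h0).2 (by nlinarith : a * ‖f.mult i‖ < a))
  have hb0 : 0 < b := ha.trans hb
  rw [lt_div_iff₀ h0] at hb'
  have hn : ‖(b : ℂ)‖ = b := by simp [abs_of_pos hb0]
  exact ⟨⟨fun _ => (b : ℂ), by
    refine ⟨?_, ?_⟩ <;> simp only [hn] <;> linarith⟩⟩

lemma ne_zero_of_mem_annulus {i : Fin n} {a : ℝ} (ha : 0 < a) {z : Fin n → ℂ}
    (hz : z ∈ annulus f i a) : z ≠ 0 := by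
  rintro rfl
  have := hz.1
  simp only [Pi.zero_apply, norm_zero] at this
  linarith

lemma exists_mem_annulus {z : Fin n → ℂ} (hz : z ≠ 0) :
    ∃ (i : Fin n) (a : ℝ), 0 < a ∧ z ∈ annulus f i a := by
  obtain ⟨i, hi⟩ := Function.ne_iff.1 hz
  have hi' : 0 < ‖z i‖ := norm_pos_iff.2 hi
  have h1 := f.norm_lt_one i
  have h0 := f.norm_pos i
  obtain ⟨a, ha, ha'⟩ := exists_between (by nlinarith : ‖f.mult i‖ * ‖z i‖ < ‖z i‖)
  exact ⟨i, a, lt_trans (by positivity) ha, ha', ha⟩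

lemma nonpos_of_iter_mem {i : Fin n} {a : ℝ} {z : Fin n → ℂ} {k : ℤ}
    (hz : z ∈ annulus f i a) (hk : f.iter k z ∈ annulus f i a) : k ≤ 0 := by
  by_contra! hpos
  have h1 : ‖f.mult i‖ ^ k ≤ ‖f.mult i‖ := by
    have := zpow_le_zpow_right_of_le_one₀ (f.norm_pos i) (f.norm_lt_one i).le
      (show (1 : ℤ) ≤ k by lia)
    simpa using this
  have h2 := hk.1
  simp only [DiagonalContraction.iter, norm_mul, norm_zpow] at h2
  have h3 := hz.2
  have h4 := mul_le_mul_of_nonneg_right h1 (norm_nonneg (z i))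
  linarith

/-- The restriction of `π` to an annulus. -/
def annulusProj (i : Fin n) {a : ℝ} (ha : 0 < a) (z : annulus f i a) : HopfManifold f :=
  proj f ⟨z.1, ne_zero_of_mem_annulus f ha z.2⟩

lemma isOpenEmbedding_annulusProj (i : Fin n) {a : ℝ} (ha : 0 < a) :
    IsOpenEmbedding (annulusProj f i ha) := by
  have hc : Continuous (fun z : annulus f i a =>
      (⟨z.1, ne_zero_of_mem_annulus f ha z.2⟩ : PuncturedSpace n)) :=
    Continuous.subtype_mk continuous_subtype_val _
  refine IsOpenEmbedding.of_continuous_injective_isOpenMap ((continuous_proj f).comp hc) ?_ ?_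
  · intro z w h
    obtain ⟨k, hk⟩ := (proj_eq_iff f).1 h
    obtain ⟨l, hl⟩ := (proj_eq_iff f).1 h.symm
    simp only at hk hl
    have hk1 : k ≤ 0 := nonpos_of_iter_mem f z.2 (hk ▸ w.2)
    have hk2 : -k ≤ 0 := nonpos_of_iter_mem f w.2 (by rw [hk, f.iter_neg_iter]; exact z.2)
    obtain rfl : k = 0 := by lia
    rw [f.iter_zero] at hk
    exact Subtype.ext hk.symm
  · refine (isOpenMap_proj f).comp ?_
    have h2 : IsOpenMap (Subtype.val : annulus f i a → (Fin n → ℂ)) :=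
      (isOpen_annulus f i a).isOpenMap_subtype_val
    intro U hU
    refine isOpen_induced_iff.2 ⟨_, h2 U hU, ?_⟩
    ext z
    simp only [mem_preimage, mem_image]
    constructor
    · rintro ⟨w, hw, h⟩
      exact ⟨w, hw, Subtype.ext h⟩
    · rintro ⟨w, hw, rfl⟩
      exact ⟨w, hw, rfl⟩

/-- The holomorphic chart of `X` given by the inverse of `π` on an annulus. -/
noncomputable def chart (i : Fin n) {a : ℝ} (ha : 0 < a) :
    OpenPartialHomeomorph (HopfManifold f) (Fin n → ℂ) :=
  haveI := annulus_nonempty f i ha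
  ((isOpenEmbedding_annulusProj f i ha).toOpenPartialHomeomorph _).symm.trans
    ((isOpen_annulus f i a).isOpenEmbedding_subtypeVal.toOpenPartialHomeomorph _)

lemma chart_source (i : Fin n) {a : ℝ} (ha : 0 < a) :
    (chart f i ha).source = range (annulusProj f i ha) := by
  simp [chart]

lemma chart_target (i : Fin n) {a : ℝ} (ha : 0 < a) :
    (chart f i ha).target = annulus f i a := by
  simp [chart]

lemma chart_annulusProj (i : Fin n) {a : ℝ} (ha : 0 < a) (z : annulus f i a) :
    chart f i ha (annulusProj f i ha z) = z.1 := by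
  have := annulus_nonempty f i ha
  simp only [chart, OpenPartialHomeomorph.trans_apply]
  rw [IsOpenEmbedding.toOpenPartialHomeomorph_left_inv]
  rfl

lemma chart_symm_apply (i : Fin n) {a : ℝ} (ha : 0 < a) (z : annulus f i a) :
    (chart f i ha).symm z.1 = annulusProj f i ha z := by
  rw [← chart_annulusProj f i ha z, OpenPartialHomeomorph.left_inv]
  rw [chart_source]
  exact mem_range_self z

lemma exists_mem_chart_source (x : HopfManifold f) :
    ∃ p : Fin n × {a : ℝ // 0 < a}, x ∈ (chart f p.1 p.2.2).source := by
  obtain ⟨z, rfl⟩ := proj_surjective f x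
  obtain ⟨i, a, ha, hz⟩ := exists_mem_annulus f z.2
  refine ⟨(i, ⟨a, ha⟩), ?_⟩
  rw [chart_source]
  exact ⟨⟨z.1, hz⟩, rfl⟩

noncomputable instance : ChartedSpace (Fin n → ℂ) (HopfManifold f) where
  atlas := range fun p : Fin n × {a : ℝ // 0 < a} => chart f p.1 p.2.2
  chartAt x := chart f (exists_mem_chart_source f x).choose.1
    (exists_mem_chart_source f x).choose.2.2
  mem_chart_source x := (exists_mem_chart_source f x).choose_spec
  chart_mem_atlas _ := mem_range_self _

/-- The Hopf manifold is a complex manifold of dimension `n`. -/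
instance : IsManifold 𝓘(ℂ, Fin n → ℂ) ω (HopfManifold f) := by
  apply isManifold_of_contDiffOn
  rintro _ _ ⟨⟨i, a, ha⟩, rfl⟩ ⟨⟨j, b, hb⟩, rfl⟩
  simp only [modelWithCornersSelf_coe, modelWithCornersSelf_coe_symm, Function.id_comp,
    Function.comp_id, range_id, inter_univ, preimage_id]
  rintro z ⟨hz, hz'⟩
  rw [OpenPartialHomeomorph.symm_symm, chart_target] at hz
  rw [OpenPartialHomeomorph.symm_symm, mem_preimage, chart_source, chart_symm_apply f i ha ⟨z, hz⟩] at hz'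
  obtain ⟨w, hw⟩ := hz'
  obtain ⟨k, hk⟩ := (proj_eq_iff f).1 hw.symm
  simp only at hk
  refine ContDiffAt.contDiffWithinAt ?_
  refine ((f.contDiff_iter k).contDiffAt).congr_of_eventuallyEq ?_
  have h1 : ∀ᶠ y in 𝓝 z, y ∈ annulus f i a := (isOpen_annulus f i a).mem_nhds hz
  have h2 : ∀ᶠ y in 𝓝 z, f.iter k y ∈ annulus f j b :=
    (f.contDiff_iter k).continuous.continuousAt.eventually
      ((isOpen_annulus f j b).mem_nhds (hk ▸ w.2))
  filter_upwards [h1, h2] with y hy hy'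
  rw [OpenPartialHomeomorph.coe_trans, Function.comp_apply, chart_symm_apply f i ha ⟨y, hy⟩]
  have : annulusProj f i ha ⟨y, hy⟩ = annulusProj f j hb ⟨f.iter k y, hy'⟩ :=
    (proj_eq_iff f).2 ⟨k, rfl⟩
  rw [this, chart_annulusProj]

end HopfManifold

/-! ### Holomorphic distributions -/

section Distribution

variable (E : Type*) [NormedAddCommGroup E] [NormedSpace ℂ E]
  (M : Type*) [TopologicalSpace M] [ChartedSpace E M] [IsManifold 𝓘(ℂ, E) ω M]

/-- A nonsingular holomorphic distribution of dimension `k` on a complex manifold `M`: a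
holomorphic vector subbundle of rank `k` of the holomorphic tangent bundle `TM`, that is, a
family of subspaces of the tangent spaces which near every point has a frame of `k` holomorphic
vector fields. -/
structure HolomorphicDistribution (k : ℕ) where
  /-- the fibres of the subbundle -/
  fiber : ∀ x : M, Submodule ℂ (TangentSpace 𝓘(ℂ, E) x)
  exists_frame : ∀ x₀ : M, ∃ U : Set M, IsOpen U ∧ x₀ ∈ U ∧
    ∃ V : Fin k → ∀ x : M, TangentSpace 𝓘(ℂ, E) x,
      (∀ i, ContMDiffOn 𝓘(ℂ, E) 𝓘(ℂ, E).tangent ω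
        (fun x => (⟨x, V i x⟩ : TangentBundle 𝓘(ℂ, E) M)) U) ∧
      ∀ x ∈ U, LinearIndependent ℂ (fun i => V i x) ∧
        Submodule.span ℂ (range fun i => V i x) = fiber x

variable {E M}

/-- Integrability: `[T𝓕, T𝓕] ⊆ T𝓕`, that is, the Lie bracket of any two local holomorphic vector
fields tangent to the distribution is tangent to the distribution. -/
def HolomorphicDistribution.IsIntegrable {k : ℕ} (D : HolomorphicDistribution E M k) : Prop :=
  ∀ (U : Set M), IsOpen U → ∀ V W : ∀ x : M, TangentSpace 𝓘(ℂ, E) x,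
    ContMDiffOn 𝓘(ℂ, E) 𝓘(ℂ, E).tangent ω
      (fun x => (⟨x, V x⟩ : TangentBundle 𝓘(ℂ, E) M)) U →
    ContMDiffOn 𝓘(ℂ, E) 𝓘(ℂ, E).tangent ω
      (fun x => (⟨x, W x⟩ : TangentBundle 𝓘(ℂ, E) M)) U →
    (∀ x ∈ U, V x ∈ D.fiber x) → (∀ x ∈ U, W x ∈ D.fiber x) →
    ∀ x ∈ U, VectorField.mlieBracket 𝓘(ℂ, E) V W x ∈ D.fiber x

end Distribution

/-! ### Fields of lines with local analytic generators -/

/-! Pull `D` back along π : ℂⁿ∖{0} → X. Its annihilator is a field of lines Φ of covectors, locally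
spanned by an analytic covector and preserved by f: μᵢ Φ(fz)ᵢ = c Φ(z)ᵢ for some scalar c ≠ 0
depending on z. The point is that this field is constant (`exists_constant_line`). The pull-back of
`D` is then the kernel of a form Σ qᵢ dzᵢ with constant coefficients. Such a form is closed, so
brackets of tangent fields stay tangent (`isIntegrable_of_constant`).

Constancy is read off along the last coordinate axis N. Fix k with Φₖ ≠ 0 at e_N. First, Φₖ has no
zero on the punctured axis (`axis_coord_ne_zero`). In a coordinate plane containing the axis, the
quotients Φᵢ/Φₖ are meromorphic on every parallel line, since only the axis itself meets the origin.
A Levi-type extension argument makes them meromorphic at the origin on the axis as well. A zero of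
Φₖ would spread under f to zeros accumulating at the origin, and some quotient would have infinitely
many poles there.

Second, hᵢ = Φᵢ/Φₖ is now analytic along the punctured axis and satisfies hᵢ ∘ f = (μₖ/μᵢ) hᵢ. A
transversal Taylor coefficient of hᵢ in directions s is a function of ζ ∈ ℂ∖{0} that ζ ↦ μ_N ζ
multiplies by a constant. By its Laurent expansion it is zero unless there is a resonance ∏ μ_{s a}
· μ_N^p · μᵢ = μₖ (`eventually_eq_zero_of_diag`). The lack of relations permits few resonances
(`HasNoRelation.resonance`): hᵢ is constant for i ≠ N, and if k ≠ N then h_N = L(z)/z_N with L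
linear. The identity principle carries these equations to all of ℂⁿ∖{0}. As n ≥ 3, the locus z_N = L
= 0 contains a nonzero point, and L ≠ 0 would force the whole covector to vanish there. So L = 0 and
the line is constant. -/

section AnalyticLift

variable {ι : Type*} [Fintype ι] {E : Type*} [NormedAddCommGroup E] [NormedSpace ℂ E]

/-- Near `z`, the line spanned by `Φ` is spanned by a nowhere vanishing analytic function. -/
def HasAnalyticLift (Φ : E → ι → ℂ) (z : E) : Prop :=
  ∃ η : E → ι → ℂ, AnalyticAt ℂ η z ∧ η z ≠ 0 ∧ ∀ᶠ w in 𝓝 z, ∃ c : ℂ, c ≠ 0 ∧ Φ w = c • η w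

namespace HasAnalyticLift

variable {Φ : E → ι → ℂ} {z : E}

lemma comp {F : Type*} [NormedAddCommGroup F] [NormedSpace ℂ F] {g : F → E} {x : F}
    (h : HasAnalyticLift Φ (g x)) (hg : AnalyticAt ℂ g x) :
    HasAnalyticLift (fun y => Φ (g y)) x := by
  obtain ⟨η, h1, h2, h3⟩ := h
  exact ⟨fun y => η (g y), h1.comp hg, h2, hg.continuousAt.eventually h3⟩

/-- `Φ` is defined only up to a pointwise scalar and need not be continuous, so a pairing with it
has no meaningful values. Its zero set is meaningful, and agrees locally with that of an analytic
function. -/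
lemma pairing (h : HasAnalyticLift Φ z) {l : E → ι → ℂ} (hl : AnalyticAt ℂ l z) :
    ∃ a : E → ℂ, AnalyticAt ℂ a z ∧ ∀ᶠ w in 𝓝 z, (∑ i, l w i * Φ w i = 0 ↔ a w = 0) := by
  obtain ⟨η, h1, h2, h3⟩ := h
  refine ⟨fun w => ∑ i, l w i * η w i, ?_, ?_⟩
  · refine Finset.analyticAt_fun_sum _ fun i _ => ?_
    exact ((analyticAt_pi_iff.1 hl) i).mul ((analyticAt_pi_iff.1 h1) i)
  · filter_upwards [h3] with w ⟨c, hc, hw⟩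
    have : ∑ i, l w i * Φ w i = c * ∑ i, l w i * η w i := by
      rw [hw, Finset.mul_sum]
      exact Finset.sum_congr rfl fun i _ => by simp only [Pi.smul_apply, smul_eq_mul]; ring
    rw [this, mul_eq_zero]
    tauto

/-- Identity principle for linear conditions on a field of lines. -/
theorem pairing_eq_zero {U : Set E} (hU : IsPreconnected U) (hΦ : ∀ z ∈ U, HasAnalyticLift Φ z)
    {l : E → ι → ℂ} (hl : ∀ z ∈ U, AnalyticAt ℂ l z) {z₀ : E} (hz₀ : z₀ ∈ U)
    (h : ∀ᶠ w in 𝓝 z₀, ∑ i, l w i * Φ w i = 0) : ∀ z ∈ U, ∑ i, l z i * Φ z i = 0 := by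
  set S : Set E := {z | ∀ᶠ w in 𝓝 z, ∑ i, l w i * Φ w i = 0} with hS
  have hopen : IsOpen S := isOpen_iff_mem_nhds.2 fun z hz => eventually_eventually_nhds.2 hz
  have hsub : U ⊆ S := by
    -- `S` is also relatively closed: near a limit point the pairing has the zeros of one analytic
    -- function on a ball, and that function vanishes near a point of the ball.
    refine hU.subset_of_closure_inter_subset hopen ⟨z₀, hz₀, h⟩ ?_
    rintro z ⟨hzc, hzU⟩
    obtain ⟨a, ha, hac⟩ := (hΦ z hzU).pairing (hl z hzU)
    obtain ⟨ε, hε, hb⟩ := Metric.eventually_nhds_iff_ball.1 (ha.eventually_analyticAt.and hac)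
    obtain ⟨w, hw, hwS⟩ := mem_closure_iff_nhds.1 hzc _ (Metric.ball_mem_nhds z hε)
    have h0 : ∀ᶠ y in 𝓝 w, a y = 0 := by
      filter_upwards [hwS, Metric.isOpen_ball.mem_nhds hw] with y hy hyb
      exact ((hb y hyb).2).1 hy
    let : NormedSpace ℝ E := NormedSpace.restrictScalars ℝ ℂ E
    have hEq := AnalyticOnNhd.eqOn_zero_of_preconnected_of_eventuallyEq_zero
      (fun y hy => (hb y hy).1) (convex_ball z ε).isPreconnected hw h0
    filter_upwards [Metric.ball_mem_nhds z hε] with y hy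
    exact ((hb y hy).2).2 (hEq hy)
  exact fun z hz => (hsub hz).self_of_nhds

lemma exists_ne_zero (h : HasAnalyticLift Φ z) : ∃ i, Φ z i ≠ 0 := by
  obtain ⟨η, h1, h2, h3⟩ := h
  obtain ⟨c, hc, hz⟩ := h3.self_of_nhds
  obtain ⟨i, hi⟩ := Function.ne_iff.1 h2
  exact ⟨i, by rw [hz]; exact mul_ne_zero hc hi⟩

/-- A quotient of coordinates of a field of lines is analytic where the denominator is nonzero. -/
lemma analyticAt_div (h : HasAnalyticLift Φ z) (i : ι) {k : ι} (hk : Φ z k ≠ 0) :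
    AnalyticAt ℂ (fun w => Φ w i / Φ w k) z := by
  obtain ⟨η, h1, h2, h3⟩ := h
  have h1' := fun j => (analyticAt_pi_iff.1 h1) j
  obtain ⟨c, hc, hz⟩ := h3.self_of_nhds
  have hηk : η z k ≠ 0 := by
    intro h0; apply hk; rw [hz]; simp [h0]
  refine ((h1' i).div (h1' k) hηk).congr ?_
  filter_upwards [h3] with w ⟨c, hc, hw⟩
  simp only [hw, Pi.smul_apply, smul_eq_mul, Pi.div_apply]
  rw [mul_div_mul_left _ _ hc]

lemma eventually_coord_ne_zero (h : HasAnalyticLift Φ z) {k : ι} (hk : Φ z k ≠ 0) :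
    ∀ᶠ w in 𝓝 z, Φ w k ≠ 0 := by
  obtain ⟨η, h1, h2, h3⟩ := h
  have h1' := fun j => (analyticAt_pi_iff.1 h1) j
  obtain ⟨c, hc, hz⟩ := h3.self_of_nhds
  have hηk : η z k ≠ 0 := by
    intro h0; apply hk; rw [hz]; simp [h0]
  filter_upwards [h3, (h1' k).continuousAt.eventually_ne hηk] with w ⟨c, hc, hw⟩ hne
  rw [hw]
  exact mul_ne_zero hc hne

/-- A coordinate which vanishes at points accumulating at `z` vanishes at `z`. -/
lemma coord_eq_zero_of_frequently (h : HasAnalyticLift Φ z) {k : ι}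
    (hk : ∃ᶠ w in 𝓝 z, Φ w k = 0) : Φ z k = 0 := by
  by_contra hne
  exact hk (h.eventually_coord_ne_zero hne)

/-- In one variable the local analytic representative is either identically zero near the point or
has isolated zeros. The identity principle excludes the first case. -/
lemma pairing_isolated {Φ : ℂ → ι → ℂ} {U : Set ℂ} (hU : IsPreconnected U)
    (hΦ : ∀ z ∈ U, HasAnalyticLift Φ z)
    {l : ℂ → ι → ℂ} (hl : ∀ z ∈ U, AnalyticAt ℂ l z) {z₀ : ℂ} (hz₀ : z₀ ∈ U)
    (h : ∑ i, l z₀ i * Φ z₀ i ≠ 0) {z : ℂ} (hz : z ∈ U) :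
    ∀ᶠ w in 𝓝[≠] z, ∑ i, l w i * Φ w i ≠ 0 := by
  obtain ⟨a, ha, hac⟩ := (hΦ z hz).pairing (hl z hz)
  rcases ha.eventually_eq_zero_or_eventually_ne_zero with h0 | h0
  · refine absurd (pairing_eq_zero hU hΦ hl hz ?_ z₀ hz₀) h
    filter_upwards [h0, hac] with w h1 h2
    exact h2.2 h1
  · filter_upwards [h0, hac.filter_mono nhdsWithin_le_nhds] with w h1 h2
    exact fun h3 => h1 (h2.1 h3)

lemma coord_isolated [DecidableEq ι] {Φ : ℂ → ι → ℂ} {U : Set ℂ} (hU : IsPreconnected U)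
    (hΦ : ∀ z ∈ U, HasAnalyticLift Φ z) {k : ι} {z₀ : ℂ} (hz₀ : z₀ ∈ U)
    (h : Φ z₀ k ≠ 0) {z : ℂ} (hz : z ∈ U) :
    ∀ᶠ w in 𝓝[≠] z, Φ w k ≠ 0 := by
  have := pairing_isolated hU hΦ (l := fun _ => Pi.single k 1) (fun _ _ => analyticAt_const) hz₀
    (by simpa [Pi.single_apply] using h) hz
  simpa [Pi.single_apply] using this

end HasAnalyticLift

end AnalyticLift

/-- A set all of whose points in `U` are isolated from it is countable in `U`. -/
lemma countable_of_isolated {X : Type*} [TopologicalSpace X] [SecondCountableTopology X]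
    {S U : Set X} (h : ∀ x ∈ U, ∀ᶠ y in 𝓝[≠] x, y ∉ S) : (S ∩ U).Countable := by
  have h' : ∀ x ∈ U, {y | y ≠ x → y ∉ S} ∈ 𝓝[U] x := fun x hx =>
    mem_nhdsWithin_of_mem_nhds (eventually_nhdsWithin_iff.1 (h x hx))
  obtain ⟨t, htU, htc, hcov⟩ := TopologicalSpace.countable_cover_nhdsWithin h'
  refine htc.mono fun y hy => ?_
  obtain ⟨x, hxt, hxy⟩ := mem_iUnion₂.1 (hcov hy.2)
  by_cases hyx : y = x
  · exact hyx ▸ hxt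
  · exact absurd hy.1 (hxy hyx)

/-! ### Circle integrals and Laurent coefficients -/

/-- A continuous function on a circle all of whose Laurent coefficients vanish is zero. -/
theorem eq_zero_of_circleIntegral_zpow_eq_zero {F : ℂ → ℂ} {R : ℝ} (hR : 0 < R)
    (hF : ContinuousOn F (Metric.sphere 0 R))
    (h : ∀ j : ℤ, (∮ z in C(0, R), F z * z ^ j) = 0) {z : ℂ} (hz : ‖z‖ = R) : F z = 0 := by
  have : Fact (0 < 2 * Real.pi) := ⟨by positivity⟩
  have hper : Function.Periodic (fun θ : ℝ => F (circleMap 0 R θ)) (2 * Real.pi) := fun θ => by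
    simp only [periodic_circleMap 0 R θ]
  have hcont : Continuous (fun θ : ℝ => F (circleMap 0 R θ)) := by
    refine hF.comp_continuous (continuous_circleMap 0 R) fun θ => circleMap_mem_sphere 0 hR.le θ
  let f : C(AddCircle (2 * Real.pi), ℂ) :=
    ⟨hper.lift, continuous_coinduced_dom.2 hcont⟩
  have hcoe : ∀ θ : ℝ, f (θ : AddCircle (2 * Real.pi)) = F (circleMap 0 R θ) := fun θ => rfl
  have hRne : (R : ℂ) ≠ 0 := by exact_mod_cast hR.ne'
  have hzero : ∀ m : ℤ, fourierCoeff f m = 0 := by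
    intro m
    rw [fourierCoeff_eq_intervalIntegral f m 0, zero_add]
    -- The exponent is -m - 1 because dz = i z dθ contributes one more factor z.
    have h1 := h (-m - 1)
    rw [circleIntegral] at h1
    have h2 : ∀ θ : ℝ, deriv (circleMap 0 R) θ • (F (circleMap 0 R θ) *
        circleMap 0 R θ ^ (-m - 1)) = (Complex.I * (R : ℂ) ^ (-m)) *
        ((fourier (-m) (θ : AddCircle (2 * Real.pi)) : ℂ) • f (θ : AddCircle (2 * Real.pi))) := by
      intro θ
      rw [deriv_circleMap, hcoe, fourier_coe_apply, zpow_sub_one₀ (by simp [hR.ne'])]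
      have hne : circleMap 0 R θ ≠ 0 := by simp [hR.ne']
      simp only [smul_eq_mul]
      have h3 : circleMap 0 R θ ^ (-m) = (R : ℂ) ^ (-m) *
          Complex.exp (2 * Real.pi * Complex.I * ((-m : ℤ) : ℂ) * θ / ((2 * Real.pi : ℝ) : ℂ)) := by
        simp only [circleMap, zero_add, mul_zpow]
        congr 1
        rw [← Complex.exp_int_mul]
        congr 1
        have : (Real.pi : ℂ) ≠ 0 := by exact_mod_cast Real.pi_ne_zero
        push_cast
        field_simp
      rw [h3]
      field_simp
    simp_rw [h2] at h1
    rw [intervalIntegral.integral_const_mul] at h1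
    rcases mul_eq_zero.1 h1 with h4 | h4
    · exact absurd h4 (mul_ne_zero Complex.I_ne_zero (zpow_ne_zero _ hRne))
    · rw [h4, smul_zero]
  -- The Fourier coefficients all vanish, hence are summable, so the Fourier series converges
  -- pointwise to `f`.
  have hsum := has_pointwise_sum_fourier_series_of_summable (f := f)
    (by rw [show fourierCoeff (f : AddCircle (2 * Real.pi) → ℂ) = 0 from funext hzero]
        exact summable_zero) ((Complex.arg z : ℝ) : AddCircle (2 * Real.pi))
  simp only [hzero, zero_smul] at hsum
  have h5 := hsum.unique hasSum_zero
  rw [hcoe] at h5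
  have h6 : circleMap 0 R (Complex.arg z) = z := by
    rw [circleMap, zero_add, ← hz]
    exact Complex.norm_mul_exp_arg_mul_I z
  rwa [h6] at h5

lemma circleIntegral_eq_of_analytic_annulus {F : ℂ → ℂ} {r R : ℝ} (hr : 0 < r) (hrR : r ≤ R)
    (hF : ∀ z : ℂ, r ≤ ‖z‖ → ‖z‖ ≤ R → AnalyticAt ℂ F z) :
    (∮ z in C(0, R), F z) = ∮ z in C(0, r), F z := by
  refine Complex.circleIntegral_eq_of_differentiable_on_annulus_off_countable hr hrR
    countable_empty ?_ ?_
  · rintro z ⟨h1, h2⟩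
    simp only [Metric.mem_closedBall, Metric.mem_ball, dist_zero_right, not_lt] at h1 h2
    exact (hF z h2 h1).continuousAt.continuousWithinAt
  · rintro z ⟨⟨h1, h2⟩, -⟩
    simp only [Metric.mem_closedBall, Metric.mem_ball, dist_zero_right, not_le] at h1 h2
    exact (hF z h2.le h1.le).differentiableAt

/-- A function on `ℂ \ {0}` with `g (μ z) = lam * g z` vanishes unless `lam` is a power of `μ`, and
then it vanishes if it vanishes at `1`. -/
theorem eq_zero_of_multiplicative {g : ℂ → ℂ} {μ lam : ℂ} (hμ0 : 0 < ‖μ‖) (hμ1 : ‖μ‖ < 1)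
    (hg : ∀ z ≠ 0, AnalyticAt ℂ g z) (hmul : ∀ z ≠ 0, g (μ * z) = lam * g z)
    (h1 : ∀ p : ℤ, lam = μ ^ p → g 1 = 0) : ∀ z ≠ 0, g z = 0 := by
  have hμne : μ ≠ 0 := norm_pos_iff.1 hμ0
  have hana : ∀ j : ℤ, ∀ z : ℂ, z ≠ 0 → AnalyticAt ℂ (fun z => g z * z ^ j) z := fun j z hz =>
    (hg z hz).mul (analyticAt_id.zpow hz)
  -- all Laurent coefficients are independent of the radius
  have hrad : ∀ j : ℤ, ∀ R : ℝ, 0 < R →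
      (∮ z in C(0, R), g z * z ^ j) = ∮ z in C(0, 1), g z * z ^ j := by
    intro j R hR
    rcases le_total R 1 with h | h
    · refine (circleIntegral_eq_of_analytic_annulus hR h fun z hz _ => hana j z ?_).symm
      exact norm_pos_iff.1 (hR.trans_le hz)
    · refine circleIntegral_eq_of_analytic_annulus one_pos h fun z hz _ => hana j z ?_
      exact norm_pos_iff.1 (one_pos.trans_le hz)
  -- scaling
  have hscale : ∀ j : ℤ, (∮ z in C(0, 1), g z * z ^ j) =
      lam * μ ^ (j + 1) * ∮ z in C(0, 1), g z * z ^ j := by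
    intro j
    -- Multiplication by μ takes the unit circle to the circle of radius ‖μ‖ and shifts the angle by
    -- arg μ. The shift does not affect an integral over a full period.
    have hrot : (∮ z in C(0, ‖μ‖), g z * z ^ j) = μ * ∮ z in C(0, 1), g (μ * z) * (μ * z) ^ j := by
      set F : ℂ → ℂ := fun z => g z * z ^ j
      have e1 : ∀ θ : ℝ, circleMap 0 ‖μ‖ (θ + Complex.arg μ) = μ * circleMap 0 1 θ := by
        intro θ
        simp only [circleMap, zero_add, Complex.ofReal_one, one_mul, Complex.ofReal_add]
        conv_rhs => rw [← Complex.norm_mul_exp_arg_mul_I μ]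
        rw [add_mul, Complex.exp_add]
        ring
      simp only [circleIntegral, deriv_circleMap, smul_eq_mul]
      rw [← intervalIntegral.integral_const_mul]
      have hper : Function.Periodic
          (fun θ : ℝ => circleMap 0 ‖μ‖ θ * Complex.I * F (circleMap 0 ‖μ‖ θ)) (2 * Real.pi) := by
        intro θ
        simp only [periodic_circleMap 0 ‖μ‖ θ]
      have h3 := hper.intervalIntegral_add_eq (Complex.arg μ) 0
      rw [zero_add] at h3
      rw [← h3]
      have h4 := intervalIntegral.integral_comp_add_right (a := 0) (b := 2 * Real.pi)
        (fun θ : ℝ => circleMap 0 ‖μ‖ θ * Complex.I * F (circleMap 0 ‖μ‖ θ)) (Complex.arg μ)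
      rw [zero_add, add_comm (2 * Real.pi)] at h4
      rw [← h4]
      refine intervalIntegral.integral_congr fun θ _ => ?_
      simp only [e1]
      ring
    have h2 : (∮ z in C(0, 1), g (μ * z) * (μ * z) ^ j) =
        ∮ z in C(0, 1), (lam * μ ^ j) * (g z * z ^ j) := by
      refine circleIntegral.integral_congr zero_le_one fun z hz => ?_
      have hz0 : z ≠ 0 := by
        rintro rfl
        simp at hz
      rw [hmul z hz0, mul_zpow]
      ring
    conv_lhs => rw [← hrad j ‖μ‖ hμ0, hrot, h2, circleIntegral.integral_const_mul]
    rw [zpow_add_one₀ hμne]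
    ring
  have hinj : ∀ p q : ℤ, μ ^ p = μ ^ q → p = q := by
    intro p q hpq
    have := congrArg norm hpq
    rw [norm_zpow, norm_zpow] at this
    exact zpow_right_injective₀ hμ0 hμ1.ne this
  have hvanish : ∀ j : ℤ, lam * μ ^ (j + 1) ≠ 1 → (∮ z in C(0, 1), g z * z ^ j) = 0 := by
    intro j hj
    have := hscale j
    have h3 : (1 - lam * μ ^ (j + 1)) * (∮ z in C(0, 1), g z * z ^ j) = 0 := by
      rw [sub_mul, one_mul, ← this, sub_self]
    rcases mul_eq_zero.1 h3 with h4 | h4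
    · exact absurd (sub_eq_zero.1 h4).symm hj
    · exact h4
  by_cases hp : ∃ p : ℤ, lam = μ ^ p
  · obtain ⟨p, hp⟩ := hp
    -- Powers of μ are distinct, so only the Laurent coefficient of z^p can survive. It is `a`, and
    -- g = a z^p follows by comparing all coefficients.
    set a : ℂ := (2 * Real.pi * Complex.I)⁻¹ * ∮ z in C(0, 1), g z * z ^ (-p - 1) with ha
    have key : ∀ z ≠ 0, g z - a * z ^ p = 0 := by
      intro z hz
      refine eq_zero_of_circleIntegral_zpow_eq_zero (F := fun z => g z - a * z ^ p)
        (norm_pos_iff.2 hz) ?_ ?_ rfl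
      · intro w hw
        have hw0 : w ≠ 0 := by
          rintro rfl
          simp only [mem_sphere_iff_norm, sub_zero, norm_zero] at hw
          exact hz (norm_eq_zero.1 hw.symm)
        exact ((hg w hw0).sub (analyticAt_const.mul (analyticAt_id.zpow hw0))
          ).continuousAt.continuousWithinAt
      · intro j
        have hzpos := norm_pos_iff.2 hz
        have e1 : (∮ w in C(0, ‖z‖), (g w - a * w ^ p) * w ^ j) =
            (∮ w in C(0, ‖z‖), g w * w ^ j) - ∮ w in C(0, ‖z‖), a * (w - 0) ^ (p + j) := by
          rw [← circleIntegral.integral_sub]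
          · refine circleIntegral.integral_congr hzpos.le fun w hw => ?_
            have hw0 : w ≠ 0 := by
              rintro rfl
              simp only [mem_sphere_iff_norm, sub_zero, norm_zero] at hw
              exact hzpos.ne hw
            simp only [sub_zero]
            rw [zpow_add₀ hw0]
            ring
          all_goals
            refine ContinuousOn.circleIntegrable hzpos.le fun w hw => ?_
            have hw0 : w ≠ 0 := by
              rintro rfl
              simp only [mem_sphere_iff_norm, sub_zero, norm_zero] at hw
              exact hzpos.ne hw
          · exact (hana j w hw0).continuousAt.continuousWithinAt
          · simp only [sub_zero]
            exact (continuousAt_const.mul (continuousAt_zpow₀ w _ (Or.inl hw0))).continuousWithinAt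
        rw [e1, hrad j _ hzpos, circleIntegral.integral_const_mul]
        by_cases hj : p + j = -1
        · have : j = -p - 1 := by lia
          rw [hj]
          have h5 := circleIntegral.integral_sub_center_inv (0 : ℂ) hzpos.ne'
          simp only [zpow_neg_one]
          rw [h5, this, ha]
          have : (2 * Real.pi * Complex.I : ℂ) ≠ 0 := by
            simp [Real.pi_ne_zero]
          field_simp
          ring
        · rw [circleIntegral.integral_sub_zpow_of_ne hj, mul_zero, sub_zero]
          refine hvanish j ?_
          rw [hp, ← zpow_add₀ hμne]
          intro h6
          rw [← zpow_zero μ] at h6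
          have := hinj _ _ h6
          lia
    have ha0 : a = 0 := by
      have := key 1 one_ne_zero
      rw [h1 p hp] at this
      simpa using this
    intro z hz
    simpa [ha0] using key z hz
  · intro z hz
    refine eq_zero_of_circleIntegral_zpow_eq_zero (norm_pos_iff.2 hz) ?_ ?_ rfl
    · intro w hw
      have hw0 : w ≠ 0 := by
        rintro rfl
        simp only [mem_sphere_iff_norm, sub_zero, norm_zero] at hw
        exact hz (norm_eq_zero.1 hw.symm)
      exact (hg w hw0).continuousAt.continuousWithinAt
    · intro j
      rw [hrad j _ (norm_pos_iff.2 hz)]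
      refine hvanish j fun h3 => hp ⟨-(j + 1), ?_⟩
      rw [zpow_neg]
      exact eq_inv_of_mul_eq_one_left h3

/-! ### Linear recurrences, clearing of poles and extension into a disc -/

/-- If all maximal minors of a family of vectors in `ℂ^m` vanish, the family satisfies a linear
relation. -/
lemma exists_relation_of_minors {m : ℕ} (C : ℕ → Fin m → ℂ)
    (h : ∀ J : Fin m → ℕ, (Matrix.of fun s l => C (J s) l).det = 0) :
    ∃ p : Fin m → ℂ, p ≠ 0 ∧ ∀ j, ∑ l, p l * C j l = 0 := by
  by_cases htop : Submodule.span ℂ (range C) = ⊤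
  · exfalso
    -- If the family spans, a basis extracted from it gives a nonzero minor. Otherwise a nonzero
    -- functional killing the span supplies the coefficients `p`.
    obtain ⟨κ, a, -, hspan, hli⟩ := exists_linearIndependent' ℂ C
    rw [htop] at hspan
    let b : Module.Basis κ ℂ (Fin m → ℂ) := Module.Basis.mk hli hspan.ge
    have : Fintype κ := FiniteDimensional.fintypeBasisIndex b
    have hcard : Fintype.card κ = Fintype.card (Fin m) := by
      rw [← Module.finrank_eq_card_basis b, Module.finrank_fin_fun, Fintype.card_fin]
    let e : Fin m ≃ κ := (Fintype.equivOfCardEq hcard).symm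
    have hli2 : LinearIndependent ℂ (Matrix.of fun s l => C (a (e s)) l).row :=
      hli.comp e e.injective
    have := Matrix.linearIndependent_rows_iff_isUnit.1 hli2
    rw [Matrix.isUnit_iff_isUnit_det, h fun s => a (e s)] at this
    exact not_isUnit_zero this
  · obtain ⟨φ, hφ, hle⟩ := Submodule.exists_le_ker_of_lt_top _ (lt_top_iff_ne_top.2 htop)
    refine ⟨fun l => φ (Pi.single l 1), fun h0 => hφ ?_, fun j => ?_⟩
    · refine LinearMap.pi_ext' fun l => LinearMap.ext_ring ?_
      simpa using congrFun h0 l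
    · have h1 : φ (C j) = 0 := hle (Submodule.subset_span (mem_range_self j))
      rw [LinearMap.pi_apply_eq_sum_univ φ (C j)] at h1
      rw [← h1]
      refine Finset.sum_congr rfl fun l _ => ?_
      have h2 : (Pi.single l 1 : Fin m → ℂ) = fun i => if l = i then 1 else 0 := by
        ext i
        simp [Pi.single_apply, eq_comm]
      rw [smul_eq_mul, mul_comm, ← h2]

/-- Circle integrals of an analytic function of two variables depend holomorphically on the
parameter. -/
lemma differentiableOn_circleIntegral_of_analytic {F : ℂ × ℂ → ℂ} {U : Set ℂ} (hU : IsOpen U)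
    {R : ℝ} (hR : 0 ≤ R) (hF : ∀ t ∈ U, ∀ w : ℂ, ‖w‖ = R → AnalyticAt ℂ F (t, w)) :
    DifferentiableOn ℂ (fun t => ∮ w in C(0, R), F (t, w)) U := by
  intro t₀ ht₀
  obtain ⟨δ, hδ, hsub⟩ := Metric.isOpen_iff.1 hU t₀ ht₀
  -- A compact set on which the derivative of `F` is bounded; the bound dominates the differentiated
  -- integrand.
  set K : Set (ℂ × ℂ) := Metric.closedBall t₀ (δ / 2) ×ˢ Metric.sphere 0 R with hK
  have hKc : IsCompact K := (isCompact_closedBall _ _).prod (isCompact_sphere _ _)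
  have hKan : ∀ x ∈ K, AnalyticAt ℂ F x := by
    rintro ⟨t, w⟩ ⟨ht, hw⟩
    refine hF t (hsub ?_) w (by simpa using hw)
    exact Metric.closedBall_subset_ball (by linarith) ht
  have hcontF : ContinuousOn F K := fun x hx => (hKan x hx).continuousAt.continuousWithinAt
  have hcont : ContinuousOn (fderiv ℂ F) K := fun x hx =>
    (hKan x hx).fderiv.continuousAt.continuousWithinAt
  obtain ⟨B, hB⟩ := hKc.exists_bound_of_continuousOn hcont
  have hmap : ∀ t ∈ Metric.closedBall t₀ (δ / 2), ∀ θ : ℝ, (t, circleMap 0 R θ) ∈ K :=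
    fun t ht θ => ⟨ht, circleMap_mem_sphere 0 hR θ⟩
  have hd : Continuous fun θ : ℝ => deriv (circleMap 0 R) θ := by
    simp only [deriv_circleMap]
    fun_prop
  have hcm : ∀ t ∈ Metric.closedBall t₀ (δ / 2),
      Continuous fun θ : ℝ => deriv (circleMap 0 R) θ • F (t, circleMap 0 R θ) := by
    intro t ht
    exact hd.smul (hcontF.comp_continuous (by fun_prop) (hmap t ht))
  have ht₀' : t₀ ∈ Metric.closedBall t₀ (δ / 2) := Metric.mem_closedBall_self (by linarith)
  have key := intervalIntegral.hasDerivAt_integral_of_dominated_loc_of_deriv_le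
    (μ := MeasureTheory.volume) (a := 0) (b := 2 * Real.pi)
    (F := fun (t : ℂ) (θ : ℝ) => deriv (circleMap 0 R) θ • F (t, circleMap 0 R θ))
    (F' := fun (t : ℂ) (θ : ℝ) =>
      deriv (circleMap 0 R) θ • fderiv ℂ F (t, circleMap 0 R θ) (1, 0))
    (x₀ := t₀) (s := Metric.closedBall t₀ (δ / 2)) (bound := fun _ => R * B)
    (Metric.closedBall_mem_nhds _ (by linarith)) ?_ ?_ ?_ ?_ ?_ ?_
  · exact key.2.differentiableAt.differentiableWithinAt
  · filter_upwards [Metric.closedBall_mem_nhds t₀ (half_pos hδ)] with t ht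
    exact (hcm t ht).aestronglyMeasurable
  · exact (hcm t₀ ht₀').intervalIntegrable _ _
  · refine Continuous.aestronglyMeasurable ?_
    exact hd.smul ((hcont.comp_continuous (by fun_prop) (hmap t₀ ht₀')).clm_apply continuous_const)
  · refine MeasureTheory.ae_of_all _ fun θ _ t ht => ?_
    rw [norm_smul, deriv_circleMap, norm_mul, Complex.norm_I, mul_one, norm_circleMap_zero,
      abs_of_nonneg hR]
    refine mul_le_mul_of_nonneg_left ?_ hR
    refine ((fderiv ℂ F _).le_opNorm _).trans ?_
    rw [show ‖((1 : ℂ), (0 : ℂ))‖ = 1 by simp [Prod.norm_def], mul_one]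
    exact hB _ (hmap t ht θ)
  · exact intervalIntegrable_const
  · refine MeasureTheory.ae_of_all _ fun θ _ t ht => ?_
    have h1 := (hKan _ (hmap t ht θ)).differentiableAt.hasFDerivAt
    have h2 : HasDerivAt (fun t : ℂ => (t, circleMap 0 R θ)) ((1 : ℂ), (0 : ℂ)) t :=
      (hasDerivAt_id t).prodMk (hasDerivAt_const t _)
    exact (h1.comp_hasDerivAt t h2).fun_const_smul _

/-- The poles of a function meromorphic near a compact set can be cleared by a polynomial. -/
lemma exists_polynomial_mul_analytic {g : ℂ → ℂ} {K : Set ℂ} (hK : IsCompact K)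
    (hg : ∀ z ∈ K, MeromorphicAt g z) :
    ∃ P : Polynomial ℂ, P ≠ 0 ∧ ∀ z ∈ K, AnalyticAt ℂ (fun w => P.eval w * g w) z := by
  refine hK.induction_on (p := fun S => ∃ P : Polynomial ℂ, P ≠ 0 ∧
    ∀ z ∈ S, AnalyticAt ℂ (fun w => P.eval w * g w) z) ⟨1, one_ne_zero, by simp⟩ ?_ ?_ ?_
  · rintro S T hST ⟨P, hP, h⟩
    exact ⟨P, hP, fun z hz => h z (hST hz)⟩
  · rintro S T ⟨P, hP, h⟩ ⟨Q, hQ, h'⟩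
    refine ⟨P * Q, mul_ne_zero hP hQ, ?_⟩
    have hpoly : ∀ (R : Polynomial ℂ) (z : ℂ), AnalyticAt ℂ (fun w => R.eval w) z := fun R z =>
      R.differentiable.analyticAt z
    rintro z (hz | hz)
    · refine ((hpoly Q z).mul (h z hz)).congr (Eventually.of_forall fun w => ?_)
      simp only [Pi.mul_apply, Polynomial.eval_mul]
      ring
    · refine ((hpoly P z).mul (h' z hz)).congr (Eventually.of_forall fun w => ?_)
      simp only [Pi.mul_apply, Polynomial.eval_mul]
      ring
  · intro x hx
    obtain ⟨k, hk⟩ := hg x hx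
    refine ⟨_, mem_nhdsWithin_of_mem_nhds hk.eventually_analyticAt, (Polynomial.X - Polynomial.C x) ^ k,
      pow_ne_zero _ (Polynomial.X_sub_C_ne_zero x), fun z hz => ?_⟩
    refine AnalyticAt.congr hz (Eventually.of_forall fun w => ?_)
    simp

/-- A function analytic on a closed annulus, all of whose negative Laurent coefficients vanish,
extends analytically to the disc. -/
lemma exists_extension_of_laurent {F : ℂ → ℂ} {r R : ℝ} (hr : 0 < r) (hrR : r < R)
    (hF : ∀ z : ℂ, r ≤ ‖z‖ → ‖z‖ ≤ R → AnalyticAt ℂ F z)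
    (h : ∀ j : ℕ, (∮ z in C(0, R), F z * z ^ j) = 0) :
    ∃ E : ℂ → ℂ, (∀ z ∈ Metric.ball 0 R, AnalyticAt ℂ E z) ∧
      ∀ z : ℂ, r < ‖z‖ → ‖z‖ < R → E z = F z := by
  have hR : 0 < R := hr.trans hrR
  lift R to NNReal using hR.le
  have hRc : ContinuousOn F (Metric.sphere 0 R) := fun z hz => by
    have : ‖z‖ = R := by simpa using hz
    exact (hF z (by linarith) this.le).continuousAt.continuousWithinAt
  -- The extension is the Cauchy integral of `F` over the outer circle. It is compared with `F` on
  -- the circle through z by Laurent coefficients.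
  set E : ℂ → ℂ := fun w => (2 * Real.pi * Complex.I : ℂ)⁻¹ • ∮ z in C(0, R), (z - w)⁻¹ • F z
    with hE
  have hps := hasFPowerSeriesOn_cauchy_integral (hRc.circleIntegrable hR.le) (by exact_mod_cast hR)
  have hEan : ∀ z ∈ Metric.ball 0 (R : ℝ), AnalyticAt ℂ E z := fun z hz =>
    hps.analyticAt_of_mem (by simpa [← Metric.eball_coe] using! hz)
  refine ⟨E, hEan, fun z hz1 hz2 => ?_⟩
  set s := ‖z‖ with hs
  have hs0 : 0 < s := hr.trans hz1
  have hne : ∀ w ∈ Metric.sphere (0 : ℂ) s, w ≠ 0 := fun w hw => by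
    rintro rfl
    simp only [mem_sphere_iff_norm, sub_zero, norm_zero] at hw
    exact hs0.ne hw
  have hEs : ∀ w ∈ Metric.closedBall (0 : ℂ) s, AnalyticAt ℂ E w := fun w hw =>
    hEan w (Metric.closedBall_subset_ball hz2 hw)
  refine sub_eq_zero.1 (eq_zero_of_circleIntegral_zpow_eq_zero (F := fun w => E w - F w) hs0 ?_ ?_
    hs.symm)
  · intro w hw
    have hw' : ‖w‖ = s := by simpa using hw
    exact ((hEs w (Metric.sphere_subset_closedBall hw)).continuousAt.sub
      (hF w (by linarith) (by linarith)).continuousAt).continuousWithinAt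
  · intro j
    have e1 : (∮ w in C(0, s), (E w - F w) * w ^ j) =
        (∮ w in C(0, s), E w * w ^ j) - ∮ w in C(0, s), F w * w ^ j := by
      rw [← circleIntegral.integral_sub]
      · simp only [sub_mul]
      all_goals
        refine ContinuousOn.circleIntegrable hs0.le fun w hw => ?_
        have hw' : ‖w‖ = s := by simpa using hw
      · exact ((hEs w (Metric.sphere_subset_closedBall hw)).continuousAt.mul
          (continuousAt_zpow₀ w _ (Or.inl (hne w hw)))).continuousWithinAt
      · exact ((hF w (by linarith) (by linarith)).continuousAt.mul
          (continuousAt_zpow₀ w _ (Or.inl (hne w hw)))).continuousWithinAt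
    have e2 : (∮ w in C(0, s), F w * w ^ j) = ∮ w in C(0, R), F w * w ^ j := by
      refine (circleIntegral_eq_of_analytic_annulus hs0 hz2.le fun w h1 h2 => ?_).symm
      exact (hF w (by linarith) h2).mul (analyticAt_id.zpow (norm_pos_iff.1 (hs0.trans_le h1)))
    rw [e1, e2]
    -- For j ≥ 0 both integrals vanish, by Cauchy for `E` and by hypothesis for `F`. For j < 0 both
    -- are, up to 2πi, the same Taylor coefficient of `E` at 0, by uniqueness of power series.
    rcases le_or_gt 0 j with hj | hj
    · lift j to ℕ using hj
      simp only [zpow_natCast]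
      rw [h j, sub_zero]
      refine Complex.circleIntegral_eq_zero_of_differentiable_on_off_countable hs0.le
        countable_empty ?_ ?_
      · exact fun w hw => ((hEs w hw).continuousAt.mul
          (continuous_pow j).continuousAt).continuousWithinAt
      · rintro w ⟨hw, -⟩
        exact (hEs w (Metric.ball_subset_closedBall hw)).differentiableAt.mul
          (differentiableAt_pow j)
    · obtain ⟨m, rfl⟩ : ∃ m : ℕ, j = -(m : ℤ) - 1 := ⟨(-j - 1).toNat, by lia⟩
      have hs' : (0 : NNReal) < s.toNNReal := by simpa using hs0
      have hps2 : HasFPowerSeriesOnBall E (cauchyPowerSeries E 0 s.toNNReal) 0 s.toNNReal := by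
        refine DifferentiableOn.hasFPowerSeriesOnBall (fun w hw => ?_) hs'
        rw [Real.coe_toNNReal _ hs0.le] at hw
        exact (hEs w hw).differentiableAt.differentiableWithinAt
      have hq := hps.hasFPowerSeriesAt.eq_formalMultilinearSeries hps2.hasFPowerSeriesAt
      have hq2 := congrArg (fun p : FormalMultilinearSeries ℂ ℂ ℂ => p m fun _ => 1) hq
      simp only [cauchyPowerSeries_apply, Real.coe_toNNReal _ hs0.le, sub_zero] at hq2
      have hpi : (2 * Real.pi * Complex.I : ℂ)⁻¹ ≠ 0 := by
        simp [Real.pi_ne_zero]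
      have hq3 := smul_right_injective ℂ hpi hq2
      have conv : ∀ (G : ℂ → ℂ) (a : ℝ), 0 < a → (∮ w in C(0, a), G w * w ^ (-(m : ℤ) - 1)) =
          ∮ w in C(0, a), (1 / w) ^ m • w⁻¹ • G w := by
        intro G a ha
        refine circleIntegral.integral_congr ha.le fun w hw => ?_
        have hw0 : w ≠ 0 := by
          rintro rfl
          simp only [mem_sphere_iff_norm, sub_zero, norm_zero] at hw
          exact ha.ne hw
        simp only [smul_eq_mul]
        rw [zpow_sub_one₀ hw0, zpow_neg, zpow_natCast, one_div, inv_pow]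
        ring
      rw [conv _ _ hs0, conv _ _ hR, sub_eq_zero]
      exact hq3.symm

/-- The punctured disc is the image of a half-plane under exp. -/
lemma isPreconnected_ball_diff_singleton {R : ℝ} (hR : 0 < R) :
    IsPreconnected (Metric.ball (0 : ℂ) R \ {0}) := by
  have h : Complex.exp '' {s : ℂ | s.re < Real.log R} = Metric.ball (0 : ℂ) R \ {0} := by
    ext z
    simp only [mem_image, mem_ofPred_eq, Set.mem_sdiff, Metric.mem_ball, dist_zero_right,
      mem_singleton_iff]
    constructor
    · rintro ⟨s, hs, rfl⟩
      refine ⟨?_, Complex.exp_ne_zero s⟩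
      rw [Complex.norm_exp]
      exact (Real.lt_log_iff_exp_lt hR).1 hs
    · rintro ⟨h1, h2⟩
      refine ⟨Complex.log z, ?_, Complex.exp_log h2⟩
      rw [Complex.log_re]
      exact Real.log_lt_log (norm_pos_iff.2 h2) h1
  rw [← h]
  exact (convex_halfSpace_re_lt _).isPreconnected.image _ Complex.continuous_exp.continuousOn

lemma isPreconnected_compl_zero : IsPreconnected ({0}ᶜ : Set ℂ) :=
  (isConnected_compl_singleton_of_one_lt_rank (by simp) 0).isPreconnected

/-! ### Meromorphic extension to the axis for fields of lines on ℂ² minus the origin -/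

section

variable {ι : Type*} [Fintype ι]

lemma HasAnalyticLift.meromorphicAt_div {φ : ℂ → ι → ℂ} {z : ℂ} (h : HasAnalyticLift φ z)
    (i k : ι) : MeromorphicAt (fun w => φ w i / φ w k) z := by
  obtain ⟨η, h1, h2, h3⟩ := h
  have h1' := fun j => ((analyticAt_pi_iff.1 h1) j).meromorphicAt
  refine ((h1' i).div (h1' k)).congr ?_
  filter_upwards [h3.filter_mono nhdsWithin_le_nhds] with w ⟨c, hc, hw⟩
  simp only [hw, Pi.smul_apply, smul_eq_mul, Pi.div_apply]
  rw [mul_div_mul_left _ _ hc]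

/-- If a sequence depending holomorphically on a parameter satisfies a linear recurrence relation for
every nonzero parameter, then it satisfies one for the parameter zero. -/
lemma exists_relation_at_zero {ε : ℝ} (hε : 0 < ε) {C : ℂ → ℕ → ℂ}
    (hC : ∀ j, DifferentiableOn ℂ (fun t => C t j) (Metric.ball 0 ε))
    (h : ∀ t ∈ Metric.ball (0 : ℂ) ε, t ≠ 0 →
      ∃ P : Polynomial ℂ, P ≠ 0 ∧ ∀ j, P.sum (fun l a => a * C t (l + j)) = 0) :
    ∃ P : Polynomial ℂ, P ≠ 0 ∧ ∀ j, P.sum (fun l a => a * C 0 (l + j)) = 0 := by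
  -- Parameters are sorted by the length d + 1 of a relation. Countably many `T d` cover the
  -- punctured disc, so some `T d` is uncountable, and one length serves uncountably many
  -- parameters.
  set T : ℕ → Set ℂ := fun d => {t | t ∈ Metric.ball (0 : ℂ) ε ∧
    ∃ p : Fin (d + 1) → ℂ, p ≠ 0 ∧ ∀ j, ∑ l, p l * C t (l + j) = 0} with hT
  have hcov : Metric.ball (0 : ℂ) ε \ {0} ⊆ ⋃ d, T d := by
    rintro t ⟨ht, ht0⟩
    obtain ⟨P, hP, hrel⟩ := h t ht ht0
    refine mem_iUnion.2 ⟨P.natDegree, ht, fun l => P.coeff l, fun h0 => hP ?_, fun j => ?_⟩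
    · have := congrFun h0 (Fin.last _)
      simpa using this
    · rw [← hrel j, P.sum_over_range (by simp), Finset.sum_range]
  obtain ⟨d, hd⟩ : ∃ d, ¬ (T d).Countable := by
    by_contra! hcon
    have h1 := (((countable_iUnion hcon).mono hcov).union (countable_singleton (0 : ℂ))).dense_compl ℂ
    obtain ⟨x, hx, hx'⟩ := h1.exists_mem_open Metric.isOpen_ball ⟨0, Metric.mem_ball_self hε⟩
    apply hx
    by_cases hx0 : x = 0
    · exact Or.inr hx0
    · exact Or.inl ⟨hx', hx0⟩
  have hdet : ∀ J : Fin (d + 1) → ℕ,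
      (Matrix.of fun s (l : Fin (d + 1)) => C 0 (l + J s)).det = 0 := by
    intro J
    set D : ℂ → ℂ := fun t => (Matrix.of fun s (l : Fin (d + 1)) => C t (l + J s)).det with hD
    have hDd : DifferentiableOn ℂ D (Metric.ball 0 ε) := by
      simp only [hD, Matrix.det_apply, Matrix.of_apply]
      refine DifferentiableOn.fun_sum fun σ _ => ?_
      refine DifferentiableOn.fun_const_smul ?_ _
      exact DifferentiableOn.fun_finsetProd fun l _ => hC _
    -- Each minor is analytic in t and vanishes on `T d`. Were it not identically zero, its zeros
    -- would be countable.
    rcases (hDd.analyticOnNhd Metric.isOpen_ball).eqOn_zero_or_eventually_ne_zero_of_preconnected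
      Metric.isPreconnected_ball with h0 | h0
    · exact h0 (Metric.mem_ball_self hε)
    · refine absurd ?_ hd
      have h1 : ({t | D t = 0} ∩ Metric.ball 0 ε).Countable := by
        refine countable_of_isolated fun x hx => ?_
        have := mem_codiscreteWithin.1 h0 x hx
        rw [disjoint_principal_right] at this
        filter_upwards [this, nhdsWithin_le_nhds (Metric.isOpen_ball.mem_nhds hx)] with y hy hy'
        simp only [mem_compl_iff, Set.mem_sdiff, not_and, not_not] at hy
        exact hy hy'
      refine h1.mono ?_
      rintro t ⟨ht, p, hp, hrel⟩
      refine ⟨?_, ht⟩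
      refine Matrix.exists_mulVec_eq_zero_iff.1 ⟨p, hp, ?_⟩
      ext s
      simp only [Matrix.mulVec, dotProduct, Matrix.of_apply, Pi.zero_apply]
      rw [← hrel (J s)]
      exact Finset.sum_congr rfl fun l _ => mul_comm _ _
  obtain ⟨p, hp, hrel⟩ := exists_relation_of_minors (fun j (l : Fin (d + 1)) => C 0 (l + j)) hdet
  set P : Polynomial ℂ := ∑ l : Fin (d + 1), Polynomial.monomial (l : ℕ) (p l) with hP
  have hcoeff : ∀ m : Fin (d + 1), P.coeff m = p m := by
    intro m
    simp only [hP, Polynomial.finsetSum_coeff, Polynomial.coeff_monomial, Fin.val_inj]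
    simp
  have hdeg : P.natDegree < d + 1 := Nat.lt_succ_of_le <|
    Polynomial.natDegree_sum_le_of_forall_le _ _ fun l _ =>
      (Polynomial.natDegree_monomial_le _).trans l.is_le
  refine ⟨P, fun h0 => hp ?_, fun j => ?_⟩
  · ext m
    rw [← hcoeff, h0]
    simp
  · rw [P.sum_over_range' (by simp) _ hdeg, Finset.sum_range]
    simp only [hcoeff]
    exact hrel j

/-- Let `Ψ` be a field of lines on `ℂ² \ {0}` and suppose that the zeros of its coordinates on the
axis `{0} × ℂ` are invariant under a contraction. A coordinate that does not vanish identically on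
the axis has no zero there. -/
theorem axis_coord_ne_zero [DecidableEq ι] {Ψ : ℂ × ℂ → ι → ℂ}
    (hΨ : ∀ x ≠ 0, HasAnalyticLift Ψ x)
    {μ : ℂ} (hμ0 : 0 < ‖μ‖) (hμ1 : ‖μ‖ < 1)
    (hinv : ∀ ζ : ℂ, ζ ≠ 0 → ∀ i, (Ψ (0, μ * ζ) i = 0 ↔ Ψ (0, ζ) i = 0))
    {k : ι} {ζ₁ : ℂ} (hζ₁ : ζ₁ ≠ 0) (hk : Ψ (0, ζ₁) k ≠ 0) :
    ∀ ζ : ℂ, ζ ≠ 0 → Ψ (0, ζ) k ≠ 0 := by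
  intro ζ₀ hζ₀ hzero
  have hμne : μ ≠ 0 := norm_pos_iff.1 hμ0
  have hlift : ∀ t ζ : ℂ, (t, ζ) ≠ 0 → HasAnalyticLift (fun w => Ψ (t, w)) ζ := fun t ζ h =>
    (hΨ (t, ζ) h).comp (g := fun w : ℂ => (t, w)) (analyticAt_const.prod analyticAt_id)
  have hlift0 : ∀ ζ : ℂ, ζ ≠ 0 → HasAnalyticLift (fun w => Ψ (0, w)) ζ := fun ζ h =>
    hlift 0 ζ (by simp [h])
  obtain ⟨i, hi⟩ := (hlift0 ζ₀ hζ₀).exists_ne_zero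
  have hik : i ≠ k := by
    rintro rfl
    exact hi hzero
  -- a circle without zeros
  have hcount : ({ζ | Ψ (0, ζ) k = 0} ∩ {0}ᶜ).Countable :=
    countable_of_isolated fun z hz =>
      HasAnalyticLift.coord_isolated isPreconnected_compl_zero hlift0 (z₀ := ζ₁) hζ₁ hk hz
  obtain ⟨ρ, hρZ, hρ⟩ := ((hcount.image norm).dense_compl ℝ).exists_mem_open isOpen_Ioi
    (nonempty_Ioi (a := (0 : ℝ)))
  rw [mem_Ioi] at hρ
  have hcirc : ∀ ζ : ℂ, ‖ζ‖ = ρ → Ψ (0, ζ) k ≠ 0 := fun ζ hζ h0 =>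
    hρZ ⟨ζ, ⟨h0, norm_pos_iff.1 (hζ ▸ hρ)⟩, hζ⟩
  -- a neighbourhood of the circle
  set O : Set (ℂ × ℂ) := {x | x ≠ 0 ∧ Ψ x k ≠ 0} with hO
  have hOopen : IsOpen O := isOpen_iff_mem_nhds.2 fun x hx =>
    (eventually_ne_nhds hx.1).and ((hΨ x hx.1).eventually_coord_ne_zero hx.2)
  obtain ⟨u, v, hu, hv, h0u, hsv, huv⟩ := generalized_tube_lemma (isCompact_singleton (x := (0 : ℂ)))
    (isCompact_sphere (0 : ℂ) ρ) hOopen (by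
      rintro ⟨t, ζ⟩ ⟨rfl, hζ⟩
      have hζ' : ‖ζ‖ = ρ := by simpa using hζ
      refine ⟨fun h => ?_, hcirc ζ hζ'⟩
      have : ζ = 0 := congrArg Prod.snd h
      rw [this, norm_zero] at hζ'
      exact hρ.ne hζ')
  obtain ⟨ε, hε, hεu⟩ := Metric.isOpen_iff.1 hu 0 (h0u rfl)
  obtain ⟨δ, hδ, hδv⟩ := (isCompact_sphere (0 : ℂ) ρ).exists_thickening_subset_open hv hsv
  -- ρ - δ/2 keeps the annulus within distance δ of the circle, and ρ/2 keeps r positive.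
  set r : ℝ := max (ρ - δ / 2) (ρ / 2) with hr
  have hr0 : 0 < r := lt_max_of_lt_right (half_pos hρ)
  have hrρ : r < ρ := max_lt (by linarith) (by linarith)
  have hann : ∀ ζ : ℂ, r ≤ ‖ζ‖ → ‖ζ‖ ≤ ρ → ζ ∈ v := by
    intro ζ h1 h2
    have hpos : 0 < ‖ζ‖ := hr0.trans_le h1
    refine hδv (Metric.mem_thickening_iff.2 ⟨((ρ / ‖ζ‖ : ℝ) : ℂ) * ζ, ?_, ?_⟩)
    · rw [mem_sphere_iff_norm, sub_zero, norm_mul, Complex.norm_real, Real.norm_eq_abs,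
        abs_of_pos (by positivity), div_mul_cancel₀ _ hpos.ne']
    · have e : ζ - ((ρ / ‖ζ‖ : ℝ) : ℂ) * ζ = ((1 - ρ / ‖ζ‖ : ℝ) : ℂ) * ζ := by push_cast; ring
      rw [dist_eq_norm, e, norm_mul, Complex.norm_real, Real.norm_eq_abs, abs_of_nonpos, neg_sub,
        sub_mul, one_mul, div_mul_cancel₀ _ hpos.ne']
      · have := (le_max_left _ _).trans h1
        linarith
      · rw [sub_nonpos, one_le_div hpos]
        exact h2
  set h : ℂ × ℂ → ℂ := fun x => Ψ x i / Ψ x k with hh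
  have han : ∀ x ∈ O, AnalyticAt ℂ h x := fun x hx => (hΨ x hx.1).analyticAt_div i hx.2
  have hmem : ∀ t ∈ Metric.ball (0 : ℂ) ε, ∀ ζ : ℂ, ‖ζ‖ = ρ → (t, ζ) ∈ O := fun t ht ζ hζ =>
    huv ⟨hεu ht, hsv (by simpa using hζ)⟩
  set C : ℂ → ℕ → ℂ := fun t j => ∮ ζ in C(0, ρ), h (t, ζ) * ζ ^ j with hC
  have hcirc_cont : ∀ t ∈ Metric.ball (0 : ℂ) ε, ∀ j : ℕ,
      CircleIntegrable (fun ζ => h (t, ζ) * ζ ^ j) 0 ρ := by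
    intro t ht j
    refine ContinuousOn.circleIntegrable hρ.le fun ζ hζ => ?_
    have h1 : ContinuousAt h (t, ζ) := (han _ (hmem t ht ζ (by simpa using hζ))).continuousAt
    have h2 : ContinuousAt (fun ζ : ℂ => h (t, ζ)) ζ :=
      ContinuousAt.comp (f := fun ζ : ℂ => (t, ζ)) h1 (by fun_prop)
    exact (h2.mul (continuous_pow j).continuousAt).continuousWithinAt
  have hsumC : ∀ t ∈ Metric.ball (0 : ℂ) ε, ∀ (P : Polynomial ℂ) (j : ℕ),
      P.sum (fun l a => a * C t (l + j)) =
        ∮ ζ in C(0, ρ), (P.eval ζ * h (t, ζ)) * ζ ^ j := by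
    intro t ht P j
    have e : ∀ ζ : ℂ, (P.eval ζ * h (t, ζ)) * ζ ^ j =
        ∑ l ∈ P.support, P.coeff l * (h (t, ζ) * ζ ^ (l + j)) := by
      intro ζ
      rw [P.eval_eq_sum, Polynomial.sum_def, Finset.sum_mul, Finset.sum_mul]
      exact Finset.sum_congr rfl fun l _ => by rw [pow_add]; ring
    simp only [e]
    rw [circleIntegral.integral_fun_sum]
    · simp only [circleIntegral.integral_const_mul]
      rfl
    · intro l _
      exact (hcirc_cont t ht (l + j)).const_smul (a := P.coeff l)
  -- For t ≠ 0 the line {t} × ℂ misses the origin, so h(t, ·) is meromorphic on the closed disc.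
  -- Multiplying by a polynomial that clears its poles kills all moments, which is a linear
  -- recurrence for `C t`. The recurrence passes to t = 0.
  obtain ⟨P, hP, hrel⟩ := exists_relation_at_zero hε (C := C) (fun j => by
      refine differentiableOn_circleIntegral_of_analytic (F := fun x => h x * x.2 ^ j)
        Metric.isOpen_ball hρ.le fun t ht w hw => ?_
      exact (han _ (hmem t ht w hw)).mul (analyticAt_snd.pow j)) (fun t ht ht0 => by
      obtain ⟨P, hP, hPan⟩ := exists_polynomial_mul_analytic (isCompact_closedBall (0 : ℂ) ρ)
        (g := fun ζ => h (t, ζ)) fun z _ =>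
          (hlift t z (by simp [ht0])).meromorphicAt_div i k
      refine ⟨P, hP, fun j => ?_⟩
      rw [hsumC t ht]
      refine Complex.circleIntegral_eq_zero_of_differentiable_on_off_countable hρ.le
        countable_empty ?_ ?_
      · exact fun w hw => ((hPan w hw).continuousAt.mul
          (continuous_pow j).continuousAt).continuousWithinAt
      · rintro w ⟨hw, -⟩
        exact (hPan w (Metric.ball_subset_closedBall hw)).differentiableAt.mul
          (differentiableAt_pow j))
  have h0ball : (0 : ℂ) ∈ Metric.ball (0 : ℂ) ε := Metric.mem_ball_self hε
  have hPan : ∀ z : ℂ, AnalyticAt ℂ (fun w => P.eval w) z := fun z =>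
    P.differentiable.analyticAt z
  obtain ⟨E, hE, hEF⟩ := exists_extension_of_laurent (F := fun ζ => P.eval ζ * h (0, ζ)) hr0 hrρ
    (fun z h1 h2 => (hPan z).mul ((han (0, z) (huv ⟨h0u rfl, hann z h1 h2⟩)).comp
      (f := fun w : ℂ => ((0 : ℂ), w)) (analyticAt_const.prod analyticAt_id)))
    (fun j => by rw [← hsumC 0 h0ball]; exact hrel j)
  -- the identity principle
  obtain ⟨s, hrs, hsρ⟩ := exists_between hrρ
  have hs0 : 0 < s := hr0.trans hrs
  have hsnorm : ‖(s : ℂ)‖ = s := by rw [Complex.norm_real, Real.norm_eq_abs, abs_of_pos hs0]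
  -- The condition is E Ψₖ = P Ψᵢ. It makes sense at zeros of Ψₖ too, and there it forces P = 0 as
  -- soon as Ψᵢ ≠ 0.
  have key := HasAnalyticLift.pairing_eq_zero (Φ := fun w => Ψ (0, w))
    (isPreconnected_ball_diff_singleton hρ) (fun z hz => hlift0 z hz.2)
    (l := fun w => E w • Pi.single k 1 - P.eval w • Pi.single i 1)
    (fun z hz => ((hE z hz.1).smul analyticAt_const).sub ((hPan z).smul analyticAt_const))
    (z₀ := (s : ℂ)) ⟨by rw [mem_ball_zero_iff, hsnorm]; exact hsρ, by
      simpa using hs0.ne'⟩ (by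
      have h1 : ∀ᶠ w : ℂ in 𝓝 (s : ℂ), r < ‖w‖ ∧ ‖w‖ < ρ := by
        have h2 := (continuous_norm (E := ℂ)).tendsto (s : ℂ)
        rw [hsnorm] at h2
        exact h2.eventually (Ioo_mem_nhds hrs hsρ)
      filter_upwards [h1] with w ⟨hw1, hw2⟩
      have hne : Ψ (0, w) k ≠ 0 := (huv (a := (0, w)) ⟨h0u rfl, hann w hw1.le hw2.le⟩).2
      have hEw := hEF w hw1 hw2
      simp only [hh] at hEw
      simp only [Pi.sub_apply, Pi.smul_apply, smul_eq_mul, sub_mul, Finset.sum_sub_distrib,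
        Pi.single_apply, mul_ite, mul_one, mul_zero, ite_mul, zero_mul, Finset.sum_ite_eq',
        Finset.mem_univ, if_true]
      rw [hEw]
      field_simp
      ring)
  -- infinitely many zeros of `P`
  have horbit : ∀ m : ℕ, μ ^ m * ζ₀ ≠ 0 ∧ Ψ (0, μ ^ m * ζ₀) k = 0 ∧ Ψ (0, μ ^ m * ζ₀) i ≠ 0 := by
    intro m
    induction m with
    | zero => simpa using ⟨hζ₀, hzero, hi⟩
    | succ m ih =>
      have e : μ ^ (m + 1) * ζ₀ = μ * (μ ^ m * ζ₀) := by ring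
      rw [e, hinv _ ih.1, Ne, Ne, hinv _ ih.1]
      exact ⟨mul_ne_zero hμne ih.1, ih.2⟩
  have htend : Tendsto (fun m : ℕ => μ ^ m * ζ₀) atTop (𝓝 0) := by
    simpa using (tendsto_pow_atTop_nhds_zero_of_norm_lt_one hμ1).mul_const ζ₀
  obtain ⟨m₀, hm₀⟩ := eventually_atTop.1 (htend.eventually (Metric.ball_mem_nhds 0 hρ))
  have hroots : ∀ m ≥ m₀, P.eval (μ ^ m * ζ₀) = 0 := by
    intro m hm
    have := key (μ ^ m * ζ₀) ⟨hm₀ m hm, (horbit m).1⟩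
    simp only [Pi.sub_apply, Pi.smul_apply, smul_eq_mul, sub_mul, Finset.sum_sub_distrib,
      Pi.single_apply, mul_ite, mul_one, mul_zero, ite_mul, zero_mul, Finset.sum_ite_eq',
      Finset.mem_univ, if_true, (horbit m).2.1, zero_sub, neg_eq_zero] at this
    exact (mul_eq_zero.1 this).resolve_right (horbit m).2.2
  refine hP (P.eq_zero_of_infinite_isRoot (Set.infinite_of_injective_forall_mem
    (f := fun m : ℕ => μ ^ (m₀ + m) * ζ₀) ?_ fun m => hroots _ (Nat.le_add_right _ _)))
  intro a b hab
  have h1 := congrArg norm (mul_right_cancel₀ hζ₀ hab)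
  rw [norm_pow, norm_pow] at h1
  have := pow_right_injective₀ hμ0 hμ1.ne h1
  lia

end

/-! ### Taylor coefficients transversal to a coordinate axis -/

section Axis

variable {ι : Type*}

/-- The diagonal linear automorphism of `ℂ^ι` with nonzero entries `μ`. -/
noncomputable def diagEquiv (μ : ι → ℂ) (hμ : ∀ i, μ i ≠ 0) : (ι → ℂ) ≃L[ℂ] (ι → ℂ) :=
  ContinuousLinearEquiv.piCongrRight fun i =>
    ContinuousLinearEquiv.unitsEquivAut ℂ (Units.mk0 (μ i) (hμ i))

lemma diagEquiv_apply (μ : ι → ℂ) (hμ : ∀ i, μ i ≠ 0) (z : ι → ℂ) :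
    diagEquiv μ hμ z = fun i => μ i * z i := by
  ext i
  simp [diagEquiv, mul_comm]

variable [DecidableEq ι]

lemma diagEquiv_single (μ : ι → ℂ) (hμ : ∀ i, μ i ≠ 0) (j : ι) (c : ℂ) :
    diagEquiv μ hμ (Pi.single j c) = Pi.single j (μ j * c) := by
  rw [diagEquiv_apply]
  ext i
  by_cases h : i = j
  · subst h; simp
  · simp [h]

variable [Fintype ι]

lemma analyticAt_single (N : ι) (ζ : ℂ) :
    AnalyticAt ℂ (fun ζ : ℂ => (Pi.single N ζ : ι → ℂ)) ζ :=
  (ContinuousLinearMap.single ℂ (fun _ : ι => ℂ) N).analyticAt ζ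

variable {μ : ι → ℂ} {N : ι} {G : (ι → ℂ) → ℂ} {lam : ℂ}

/-- Differentiate the eigenvector equation m times: by the chain rule each direction e_{s a}
contributes a factor μ_{s a}. -/
lemma iteratedFDeriv_diag (hμ : ∀ i, μ i ≠ 0)
    {x : ι → ℂ} (hG : AnalyticAt ℂ G x) (hmul : ∀ᶠ z in 𝓝 x, G (fun i => μ i * z i) = lam * G z)
    {m : ℕ} (s : Fin m → ι) :
    (∏ a, μ (s a)) * iteratedFDeriv ℂ m G (fun i => μ i * x i) (fun a => Pi.single (s a) 1) =
      lam * iteratedFDeriv ℂ m G x (fun a => Pi.single (s a) 1) := by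
  have h1 : G ∘ diagEquiv μ hμ =ᶠ[𝓝 x] lam • G := by
    filter_upwards [hmul] with z hz
    simpa [diagEquiv_apply] using hz
  have h2 := (h1.iteratedFDeriv ℂ m).self_of_nhds
  have h3 := (diagEquiv μ hμ).iteratedFDerivWithin_comp_right (i := m) G uniqueDiffOn_univ
    (x := x) (mem_univ _)
  rw [preimage_univ, iteratedFDerivWithin_univ, iteratedFDerivWithin_univ] at h3
  rw [h3, iteratedFDeriv_const_smul_apply hG.contDiffAt] at h2
  have h4 := congrArg (fun T => T fun a => (Pi.single (s a) 1 : ι → ℂ)) h2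
  simp only [ContinuousMultilinearMap.compContinuousLinearMap_apply,
    _root_.smul_apply, smul_eq_mul] at h4
  rw [← h4]
  have h5 : (fun a => (diagEquiv μ hμ : (ι → ℂ) →L[ℂ] (ι → ℂ)) (Pi.single (s a) 1)) =
      fun a => μ (s a) • (Pi.single (s a) 1 : ι → ℂ) := by
    ext a : 1
    rw [ContinuousLinearEquiv.coe_coe, diagEquiv_single, ← Pi.single_smul, smul_eq_mul]
  rw [h5, ContinuousMultilinearMap.map_smul_univ, diagEquiv_apply, smul_eq_mul]

/-- A function near a coordinate axis that is an eigenvector of a diagonal contraction vanishes if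
all its transversal Taylor coefficients of the right weight vanish. -/
theorem eventually_eq_zero_of_diag (hμ0 : ∀ i, μ i ≠ 0) (hμN : ‖μ N‖ < 1)
    (hG : ∀ ζ : ℂ, ζ ≠ 0 → AnalyticAt ℂ G (Pi.single N ζ))
    (hmul : ∀ ζ : ℂ, ζ ≠ 0 → ∀ᶠ z in 𝓝 (Pi.single N ζ), G (fun i => μ i * z i) = lam * G z)
    (hcoef : ∀ (m : ℕ) (s : Fin m → ι) (p : ℤ), (∀ a, s a ≠ N) →
      (∏ a, μ (s a)) * μ N ^ p = lam →
      iteratedFDeriv ℂ m G (Pi.single N 1) (fun a => Pi.single (s a) 1) = 0) :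
    ∀ᶠ z in 𝓝 (Pi.single N 1), G z = 0 := by
  have hcoefs : ∀ (m : ℕ) (s : Fin m → ι), (∀ a, s a ≠ N) → ∀ ζ : ℂ, ζ ≠ 0 →
      iteratedFDeriv ℂ m G (Pi.single N ζ) (fun a => Pi.single (s a) 1) = 0 := by
    intro m s hs
    have hprod : (∏ a, μ (s a)) ≠ 0 := Finset.prod_ne_zero_iff.2 fun a _ => hμ0 _
    refine eq_zero_of_multiplicative (μ := μ N) (lam := lam / ∏ a, μ (s a))
      (g := fun ζ => iteratedFDeriv ℂ m G (Pi.single N ζ) (fun a => Pi.single (s a) 1))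
      (norm_pos_iff.2 (hμ0 N)) hμN ?_ ?_ ?_
    · intro ζ hζ
      have h1 : AnalyticAt ℂ (iteratedFDeriv ℂ m G) (Pi.single N ζ) :=
        AnalyticOnNhd.iteratedFDeriv (s := {x | AnalyticAt ℂ G x}) (fun x hx => hx) m _ (hG ζ hζ)
      have h2 : AnalyticAt ℂ (fun ζ : ℂ => iteratedFDeriv ℂ m G (Pi.single N ζ)) ζ :=
        h1.comp (f := fun ζ : ℂ => (Pi.single N ζ : ι → ℂ)) (analyticAt_single N ζ)
      exact ((ContinuousMultilinearMap.apply ℂ (fun _ : Fin m => ι → ℂ) ℂ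
        (fun a => Pi.single (s a) 1)).analyticAt _).comp h2
    · intro ζ hζ
      have h1 := iteratedFDeriv_diag hμ0 (hG ζ hζ) (hmul ζ hζ) s
      rw [← diagEquiv_apply μ hμ0, diagEquiv_single] at h1
      rw [div_mul_eq_mul_div, ← h1, mul_div_cancel_left₀ _ hprod]
    · intro p hp
      refine hcoef m s p hs ?_
      rw [← hp, mul_div_cancel₀ _ hprod]
  obtain ⟨q, ρ, hq⟩ := hG 1 one_ne_zero
  have hball : ∀ᶠ z in 𝓝 (Pi.single N (1 : ℂ) : ι → ℂ),
      z N ≠ 0 ∧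
      ‖(Pi.single N (z N) : ι → ℂ) - Pi.single N 1‖ₑ < ρ / 2 ∧
      ‖z - Pi.single N (z N)‖ₑ < ρ / 2 := by
    have hρ : 0 < ρ / 2 := ENNReal.half_pos hq.r_pos.ne'
    have hproj : Continuous fun z : ι → ℂ => (Pi.single N (z N) : ι → ℂ) :=
      (continuous_single N).comp (continuous_apply N)
    refine ((continuous_apply N).continuousAt.eventually_ne (by simp)).and ?_
    have h1 : ContinuousAt (fun z : ι → ℂ => ‖(Pi.single N (z N) : ι → ℂ) - Pi.single N 1‖ₑ)
        (Pi.single N 1) := (hproj.sub continuous_const).enorm.continuousAt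
    have h2 : ContinuousAt (fun z : ι → ℂ => ‖z - (Pi.single N (z N) : ι → ℂ)‖ₑ)
        (Pi.single N 1) := (continuous_id.sub hproj).enorm.continuousAt
    refine (h1.eventually (gt_mem_nhds ?_)).and (h2.eventually (gt_mem_nhds ?_)) <;> simpa using hρ
  filter_upwards [hball] with z ⟨hz0, hz1, hz2⟩
  -- Here z = e_N + v + y with v along the axis and y transversal. The bounds by ρ/2 make the series
  -- recentred at e_N + v converge at y.
  set v : ι → ℂ := Pi.single N (z N) - Pi.single N 1 with hv
  set y : ι → ℂ := z - Pi.single N (z N) with hy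
  have hyN : y N = 0 := by simp [hy]
  have hv' : (‖v‖₊ : ENNReal) < ρ := hz1.trans_le ENNReal.half_le_self
  have hq2 := hq.changeOrigin hv'
  have hpt : (Pi.single N 1 : ι → ℂ) + v = Pi.single N (z N) := by simp [hv]
  rw [hpt] at hq2
  have hy' : y ∈ Metric.eball (0 : ι → ℂ) (ρ - ‖v‖₊) := by
    rw [mem_eball_zero_iff]
    refine hz2.trans_le ?_
    refine ENNReal.le_sub_of_add_le_right (by simp) ?_
    calc ρ / 2 + ‖v‖₊ ≤ ρ / 2 + ρ / 2 := by gcongr; exact hz1.le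
      _ = ρ := ENNReal.add_halves ρ
  have hsum := hq2.hasSum_iteratedFDeriv hy'
  have hzero : ∀ m : ℕ, iteratedFDeriv ℂ m G (Pi.single N (z N)) (fun _ => y) = 0 := by
    intro m
    -- Expanding in basis vectors, terms using direction N vanish because y_N = 0; the others are
    -- the transversal coefficients already shown to be zero.
    have e : (fun _ : Fin m => y) = fun _ => ∑ j, y j • (Pi.single j 1 : ι → ℂ) := by
      ext a i
      simp [Finset.sum_apply, Pi.single_apply]
    rw [e, ContinuousMultilinearMap.map_sum]
    refine Finset.sum_eq_zero fun s _ => ?_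
    rw [ContinuousMultilinearMap.map_smul_univ]
    by_cases hs : ∀ a, s a ≠ N
    · rw [hcoefs m s hs _ hz0, smul_zero]
    · push Not at hs
      obtain ⟨a, ha⟩ := hs
      rw [Finset.prod_eq_zero (Finset.mem_univ a) (by rw [ha, hyN]), zero_smul]
  simp only [hzero, smul_zero] at hsum
  have := hsum.unique hasSum_zero
  simpa [hy] using this

end Axis

/-! ### Resonances -/

section Relations

variable {n : ℕ} {μ : Fin n → ℂ}

/-- Integer exponents reduce to natural ones by moving the negative powers to the other side. -/
lemma HasNoRelation.eq_zero_of_prod_zpow {S : Finset (Fin n)} (h : HasNoRelation μ S)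
    {a : Fin n → ℤ} (ha : ∏ i ∈ S, μ i ^ a i = 1) : ∀ i ∈ S, a i = 0 := by
  have key := h (S.filter fun i => 0 ≤ a i) (S.filter fun i => ¬ 0 ≤ a i) (fun i => (a i).natAbs)
    (Finset.disjoint_filter_filter_not _ _ _) (Finset.filter_union_filter_not_eq _ _) ?_
  · exact fun i hi => Int.natAbs_eq_zero.1 (key i hi)
  · rw [← Finset.prod_filter_mul_prod_filter_not S (fun i => 0 ≤ a i)] at ha
    have h1 : ∏ i ∈ S.filter (fun i => 0 ≤ a i), μ i ^ a i =
        ∏ i ∈ S.filter (fun i => 0 ≤ a i), μ i ^ (a i).natAbs := by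
      refine Finset.prod_congr rfl fun i hi => ?_
      rw [← zpow_natCast, Int.natAbs_of_nonneg (Finset.mem_filter.1 hi).2]
    have h2 : ∏ i ∈ S.filter (fun i => ¬ 0 ≤ a i), μ i ^ a i =
        (∏ i ∈ S.filter (fun i => ¬ 0 ≤ a i), μ i ^ (a i).natAbs)⁻¹ := by
      rw [← Finset.prod_inv_distrib]
      refine Finset.prod_congr rfl fun i hi => ?_
      rw [← zpow_natCast, ← zpow_neg]
      congr 1
      have := (Finset.mem_filter.1 hi).2
      lia
    rw [h1, h2] at ha
    exact eq_of_div_eq_one (by rw [div_eq_mul_inv]; exact ha)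

/-- Resonances of a generic or intermediary diagonal contraction that can occur along the last
coordinate axis. -/
lemma HasNoRelation.resonance {r : ℕ} (hr : 1 ≤ r) {N : Fin n} (hN : r ≤ N.val)
    (hμ : ∀ i, μ i ≠ 0) (heq : ∀ i j : Fin n, i.val < r → j.val < r → μ i = μ j)
    (hrel : HasNoRelation μ (Finset.univ.filter fun i : Fin n => i.val = 0 ∨ r ≤ i.val))
    {m : ℕ} (s : Fin m → Fin n) (hs : ∀ a, s a ≠ N) (p : ℤ) (i k : Fin n)
    (h : (∏ a, μ (s a)) * μ N ^ p * μ i = μ k) :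
    (m = 0 ∧ p = 0 ∧ μ i = μ k ∧ (i = N ↔ k = N)) ∨
      (m = 1 ∧ i = N ∧ k ≠ N ∧ ∀ a, μ (s a) = μ k) := by
  set S : Finset (Fin n) := Finset.univ.filter fun i : Fin n => i.val = 0 ∨ r ≤ i.val with hS
  let o : Fin n := ⟨0, (Nat.zero_le _).trans_lt N.isLt⟩
  -- The first r multipliers coincide, so index 0 represents them all and `S` is a set of
  -- representatives. Exponents are counted there, where no relation holds.
  let cl : Fin n → Fin n := fun j => if j.val < r then o else j
  have hclS : ∀ j, cl j ∈ S := by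
    intro j
    simp only [hS, cl, Finset.mem_filter, Finset.mem_univ, true_and]
    split_ifs with hj
    · exact Or.inl rfl
    · exact Or.inr (not_lt.1 hj)
  have hclμ : ∀ j, μ (cl j) = μ j := by
    intro j
    simp only [cl]
    split_ifs with hj
    · exact heq _ _ hr hj
    · rfl
  have hclN : ∀ j, cl j = N ↔ j = N := by
    intro j
    simp only [cl]
    split_ifs with hj
    · constructor
      · intro h1
        have := congrArg Fin.val h1
        simp only [o] at this
        lia
      · rintro rfl
        lia
    · rfl
  have hcleq : ∀ i j, cl i = cl j → μ i = μ j := fun i j hij => by rw [← hclμ i, hij, hclμ]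
  let e : Fin n → Fin n → ℤ := fun j => Pi.single (cl j) 1
  let mon : (Fin n → ℤ) → ℂ := fun a => ∏ c ∈ S, μ c ^ a c
  have mon_add : ∀ a b, mon (a + b) = mon a * mon b := fun a b => by
    simp only [mon, Pi.add_apply]
    rw [← Finset.prod_mul_distrib]
    exact Finset.prod_congr rfl fun c _ => zpow_add₀ (hμ c) _ _
  have mon_e : ∀ j (q : ℤ), mon (q • e j) = μ j ^ q := fun j q => by
    simp only [mon, e]
    rw [Finset.prod_eq_single (cl j)]
    · simp [hclμ]
    · intro c _ hc
      simp [hc]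
    · exact fun hj => absurd (hclS j) hj
  have mon_sum : ∀ T : Finset (Fin m), mon (∑ a ∈ T, e (s a)) = ∏ a ∈ T, μ (s a) := by
    intro T
    induction T using Finset.induction_on with
    | empty => simp [mon]
    | insert a T ha ih =>
      rw [Finset.sum_insert ha, Finset.prod_insert ha, mon_add, ih]
      congr 1
      simpa using mon_e (s a) 1
  set a : Fin n → ℤ := (∑ x, e (s x)) + p • e N + (1 : ℤ) • e i + (-1 : ℤ) • e k with ha
  have hmon : mon a = 1 := by
    rw [ha, mon_add, mon_add, mon_add, mon_sum, mon_e, mon_e, mon_e, zpow_one, h, zpow_neg_one,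
      mul_inv_cancel₀ (hμ k)]
  have hzero : ∀ c ∈ S, a c = 0 := hrel.eq_zero_of_prod_zpow hmon
  have hzero' : ∀ c, (∑ x, e (s x) c) + p * e N c + e i c - e k c = 0 := by
    intro c
    by_cases hc : c ∈ S
    · have := hzero c hc
      simp only [ha, Pi.add_apply, Finset.sum_apply, Pi.smul_apply, smul_eq_mul] at this
      linarith
    · have h1 : ∀ j, e j c = 0 := fun j =>
        Pi.single_eq_of_ne (fun hj => hc (by rw [hj]; exact hclS j)) _
      simp [h1]
  have hesum : ∀ j, ∑ c, e j c = 1 := fun j => by simp [e]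
  -- Total degree of the relation: the contributions of i and k cancel. Together with the exponent
  -- at N this leaves few values of m and p.
  have htot : (m : ℤ) + p = 0 := by
    have h1 : ∑ c, ((∑ x, e (s x) c) + p * e N c + e i c - e k c) = 0 :=
      Finset.sum_eq_zero fun c _ => hzero' c
    rw [Finset.sum_sub_distrib, Finset.sum_add_distrib, Finset.sum_add_distrib, Finset.sum_comm,
      ← Finset.mul_sum] at h1
    simp only [hesum] at h1
    simp only [Finset.sum_const, Finset.card_univ, Fintype.card_fin, nsmul_eq_mul, mul_one] at h1
    linarith
  have heN : ∀ j, e j N = if j = N then 1 else 0 := fun j => by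
    simp only [e, Pi.single_apply]
    simp only [← hclN j, eq_comm]
  have hN0 := hzero' N
  simp only [heN, hs, if_false, Finset.sum_const_zero, if_true] at hN0
  have hcl_of : ∀ i j, e i = e j → cl i = cl j := by
    intro i j hij
    by_contra hne
    have h1 := congrFun hij (cl i)
    simp [e, hne] at h1
  by_cases hi : i = N <;> by_cases hk : k = N <;> simp only [hi, hk, if_true, if_false] at hN0
  · have hm : m = 0 := by lia
    exact Or.inl ⟨hm, by lia, by rw [hi, hk], by simp [hi, hk]⟩
  · have hm : m = 1 := by lia
    refine Or.inr ⟨hm, hi, hk, fun x => hcleq _ _ (hcl_of _ _ ?_)⟩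
    subst hm
    ext c
    have h1 := hzero' c
    rw [hi, show p = -1 by lia] at h1
    simp only [Finset.univ_unique, Finset.sum_singleton] at h1
    rw [Subsingleton.elim x default]
    linarith
  -- With i ≠ N and k = N one gets p = 1, hence m = -1, which is absurd.
  · lia
  · have hm : m = 0 := by lia
    refine Or.inl ⟨hm, by lia, hcleq _ _ (hcl_of _ _ ?_), by simp [hi, hk]⟩
    subst hm
    ext c
    have h1 := hzero' c
    rw [show p = 0 by lia] at h1
    simp only [Finset.univ_eq_empty, Finset.sum_empty] at h1
    linarith

end Relations

/-! ### Constancy of equivariant fields of lines -/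

section Constancy

variable {n : ℕ}

lemma isPreconnected_compl_zero_pi (hn : 1 ≤ n) : IsPreconnected ({0}ᶜ : Set (Fin n → ℂ)) := by
  refine (isConnected_compl_singleton_of_one_lt_rank ?_ 0).isPreconnected
  refine Module.lt_rank_of_lt_finrank ?_
  rw [Module.finrank_pi_fintype]
  simp
  lia

variable {μ : Fin n → ℂ} {N : Fin n} {Φ : (Fin n → ℂ) → Fin n → ℂ}

/-- An equivariant field of lines whose `k`-th coordinate does not vanish at a point of the last
coordinate axis has nonvanishing `k`-th coordinate on the whole axis. -/
lemma coord_ne_zero_on_axis (hn : 2 ≤ n) (hμ0 : ∀ i, 0 < ‖μ i‖) (hμ1 : ∀ i, ‖μ i‖ < 1)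
    (hΦ : ∀ z ≠ 0, HasAnalyticLift Φ z)
    (hequiv : ∀ z ≠ 0, ∃ c : ℂ, c ≠ 0 ∧ ∀ i, μ i * Φ (fun i => μ i * z i) i = c * Φ z i)
    {k : Fin n} (hk : Φ (Pi.single N 1) k ≠ 0) :
    ∀ ζ : ℂ, ζ ≠ 0 → Φ (Pi.single N ζ) k ≠ 0 := by
  obtain ⟨j, hj⟩ : ∃ j : Fin n, j ≠ N := by
    have : Nontrivial (Fin n) := Fin.nontrivial_iff_two_le.2 hn
    exact exists_ne N
  have hμne : ∀ i, μ i ≠ 0 := fun i => norm_pos_iff.1 (hμ0 i)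
  let e : ℂ × ℂ → Fin n → ℂ := fun x => Pi.single j x.1 + Pi.single N x.2
  have he0 : ∀ ζ, e (0, ζ) = Pi.single N ζ := fun ζ => by simp [e]
  have he : ∀ x ≠ 0, e x ≠ 0 := by
    rintro ⟨t, ζ⟩ hx h0
    have h1 := congrFun h0 j
    have h2 := congrFun h0 N
    simp [e, hj, hj.symm] at h1 h2
    exact hx (by rw [h1, h2]; rfl)
  have han : ∀ x, AnalyticAt ℂ e x := fun x =>
    ((analyticAt_single j _).comp (f := fun x : ℂ × ℂ => x.1) analyticAt_fst).add
      ((analyticAt_single N _).comp (f := fun x : ℂ × ℂ => x.2) analyticAt_snd)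
  have key := axis_coord_ne_zero (Ψ := fun x => Φ (e x))
    (fun x hx => (hΦ _ (he x hx)).comp (han x)) (hμ0 N) (hμ1 N) (k := k) (ζ₁ := 1) ?_ one_ne_zero
    (by rw [he0]; exact hk)
  · intro ζ hζ
    rw [← he0]
    exact key ζ hζ
  · intro ζ hζ i
    have hne : (Pi.single N ζ : Fin n → ℂ) ≠ 0 := by simpa using hζ
    obtain ⟨c, hc, h⟩ := hequiv _ hne
    have h1 := h i
    rw [← diagEquiv_apply μ hμne, diagEquiv_single] at h1
    simp only [he0]
    constructor
    · intro h2
      rw [h2, mul_zero] at h1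
      exact (mul_eq_zero.1 h1.symm).resolve_left hc
    · intro h2
      rw [h2, mul_zero] at h1
      exact (mul_eq_zero.1 h1).resolve_left (hμne i)

/-- An equivariant field of lines over the complement of the origin in `ℂⁿ` is constant, if the only
resonances along one axis are the ones permitted for a generic or intermediary contraction. -/
theorem exists_constant_line (hn : 3 ≤ n) (hμ0 : ∀ i, 0 < ‖μ i‖) (hμ1 : ∀ i, ‖μ i‖ < 1)
    (hres : ∀ (m : ℕ) (s : Fin m → Fin n), (∀ a, s a ≠ N) → ∀ (p : ℤ) (i k : Fin n),
      (∏ a, μ (s a)) * μ N ^ p * μ i = μ k →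
      (m = 0 ∧ p = 0 ∧ μ i = μ k ∧ (i = N ↔ k = N)) ∨
        (m = 1 ∧ i = N ∧ k ≠ N ∧ ∀ a, μ (s a) = μ k))
    (hΦ : ∀ z ≠ 0, HasAnalyticLift Φ z)
    (hequiv : ∀ z ≠ 0, ∃ c : ℂ, c ≠ 0 ∧ ∀ i, μ i * Φ (fun i => μ i * z i) i = c * Φ z i) :
    ∃ q : Fin n → ℂ, ∀ z ≠ 0, ∃ b : ℂ, b ≠ 0 ∧ Φ z = b • q := by
  have hμne : ∀ i, μ i ≠ 0 := fun i => norm_pos_iff.1 (hμ0 i)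
  have hax : ∀ ζ : ℂ, ζ ≠ 0 → (Pi.single N ζ : Fin n → ℂ) ≠ 0 := fun ζ hζ => by simpa using hζ
  have hW := isPreconnected_compl_zero_pi (n := n) (by lia)
  obtain ⟨k, hk1⟩ := (hΦ _ (hax 1 one_ne_zero)).exists_ne_zero
  have hk := coord_ne_zero_on_axis (by lia) hμ0 hμ1 hΦ hequiv hk1
  set h : Fin n → (Fin n → ℂ) → ℂ := fun i z => Φ z i / Φ z k with hh
  have hhan : ∀ i, ∀ ζ : ℂ, ζ ≠ 0 → AnalyticAt ℂ (h i) (Pi.single N ζ) := fun i ζ hζ =>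
    (hΦ _ (hax ζ hζ)).analyticAt_div i (hk ζ hζ)
  -- The unknown scalar of the equivariance cancels in the quotient.
  have hhmul : ∀ i, ∀ z ≠ 0, h i (fun i => μ i * z i) = μ k / μ i * h i z := by
    intro i z hz
    obtain ⟨c, hc, hcz⟩ := hequiv z hz
    have e1 : ∀ j, Φ (fun i => μ i * z i) j = c * Φ z j / μ j := fun j => by
      rw [← hcz j, mul_div_cancel_left₀ _ (hμne j)]
    simp only [hh, e1]
    rw [div_div_div_eq, mul_assoc c, mul_comm (μ i), mul_assoc c, mul_div_mul_left _ _ hc]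
    rw [div_mul_div_comm, mul_comm (μ k), mul_comm (μ i)]
  have hWnhds : ∀ ζ : ℂ, ζ ≠ 0 → ∀ᶠ z in 𝓝 (Pi.single N ζ : Fin n → ℂ), z ≠ 0 := fun ζ hζ =>
    eventually_ne_nhds (hax ζ hζ)
  have hΦk : ∀ᶠ z in 𝓝 (Pi.single N 1 : Fin n → ℂ), Φ z k ≠ 0 :=
    (hΦ _ (hax 1 one_ne_zero)).eventually_coord_ne_zero hk1
  have hsmul : ∀ {m : ℕ} {s : Fin m → Fin n} {p : ℤ} {i : Fin n},
      (∏ a, μ (s a)) * μ N ^ p = μ k / μ i → (∏ a, μ (s a)) * μ N ^ p * μ i = μ k := by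
    intro m s p i h1
    rw [h1, div_mul_cancel₀ _ (hμne i)]
  -- the coordinates transversal to the axis are constant
  have hA : ∀ i, i ≠ N → ∃ q : ℂ, (k = N → q = 0) ∧ (i = k → q = 1) ∧
      ∀ᶠ z in 𝓝 (Pi.single N 1 : Fin n → ℂ), h i z = q := by
    intro i hi
    -- Only in this case does the resonance m = p = 0 occur, so a constant must be subtracted first.
    -- Otherwise there is no resonance and h i itself vanishes.
    by_cases hik : μ i = μ k ∧ k ≠ N
    · refine ⟨h i (Pi.single N 1), fun hkN => absurd hkN hik.2, fun e => ?_, ?_⟩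
      · rw [e]
        exact div_self hk1
      have := eventually_eq_zero_of_diag (lam := μ k / μ i)
        (G := fun z => h i z - h i (Pi.single N 1)) hμne (hμ1 N)
        (fun ζ hζ => (hhan i ζ hζ).sub analyticAt_const) (fun ζ hζ => by
          filter_upwards [hWnhds ζ hζ] with z hz
          rw [hhmul i z hz, hik.1, div_self (hμne k), one_mul, one_mul]) (fun m s p hs hp => by
          rcases hres m s hs p i k (hsmul hp) with ⟨rfl, -⟩ | ⟨-, h2, -⟩
          · simp
          · exact absurd h2 hi)
      filter_upwards [this] with z hz using sub_eq_zero.1 hz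
    · refine ⟨0, fun _ => rfl, fun e => absurd ⟨congrArg μ e, e ▸ hi⟩ hik, ?_⟩
      refine eventually_eq_zero_of_diag (lam := μ k / μ i) hμne (hμ1 N) (hhan i) (fun ζ hζ => by
          filter_upwards [hWnhds ζ hζ] with z hz using hhmul i z hz) (fun m s p hs hp => ?_)
      rcases hres m s hs p i k (hsmul hp) with ⟨-, -, h1, h2⟩ | ⟨-, h2, -⟩
      · exact absurd ⟨h1, fun h3 => hi (h2.2 h3)⟩ hik
      · exact absurd h2 hi
  choose! q hqN hqk hq using hA
  -- transport to all of `ℂⁿ \ {0}`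
  have hone : ∀ i, i ≠ N → ∀ z ≠ 0, Φ z i = q i * Φ z k := by
    intro i hi z hz
    have := HasAnalyticLift.pairing_eq_zero hW (fun z hz => hΦ z hz)
      (l := fun _ => Pi.single i 1 - q i • Pi.single k 1) (fun _ _ => analyticAt_const)
      (z₀ := Pi.single N 1) (hax 1 one_ne_zero) (by
        filter_upwards [hq i hi, hΦk] with w hw hwk
        have : Φ w i = q i * Φ w k := by rw [← hw]; exact (div_mul_cancel₀ _ hwk).symm
        simp [sub_mul, Finset.sum_sub_distrib, Pi.single_apply, this]) z hz
    simpa [sub_mul, Finset.sum_sub_distrib, Pi.single_apply, sub_eq_zero] using this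
  by_cases hkN : k = N
  · refine ⟨Pi.single N 1, fun z hz => ?_⟩
    have hform : Φ z = Φ z N • Pi.single N 1 := by
      ext i
      by_cases hi : i = N
      · subst hi; simp
      · simp [hi, hone i hi z hz, hqN i hi hkN]
    refine ⟨Φ z N, fun h0 => ?_, hform⟩
    obtain ⟨i, hi⟩ := (hΦ z hz).exists_ne_zero
    rw [hform, h0] at hi
    simp at hi
  -- the coordinate along the axis
  have hqk1 : q k = 1 := hqk k hkN rfl
  -- The remaining resonance has m = 1 and p = -1: it allows terms z_j / z_N with j ≠ N and μ_j =
  -- μₖ. Their coefficients are first derivatives of `h N` at e_N.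
  set c : Fin n → ℂ := fun j =>
    if j ≠ N ∧ μ j = μ k then fderiv ℂ (h N) (Pi.single N 1) (Pi.single j 1) else 0 with hc
  have hcN : c N = 0 := by simp [hc]
  set L : (Fin n → ℂ) → ℂ := fun z => ∑ j, c j * z j with hL
  have hLan : ∀ z, AnalyticAt ℂ L z := fun z => by
    refine Finset.analyticAt_fun_sum _ fun j _ => ?_
    exact analyticAt_const.mul ((ContinuousLinearMap.proj (R := ℂ) (φ := fun _ : Fin n => ℂ)
      j).analyticAt z)
  have hLadd : ∀ z w, L (z + w) = L z + L w := fun z w => by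
    simp [hL, mul_add, Finset.sum_add_distrib]
  have hLsingle : ∀ j a, L (Pi.single j a) = c j * a := fun j a => by
    simp [hL, Pi.single_apply]
  have hprojN : ∀ z, AnalyticAt ℂ (fun z : Fin n → ℂ => z N) z := fun z =>
    (ContinuousLinearMap.proj (R := ℂ) (φ := fun _ : Fin n => ℂ) N).analyticAt z
  have hgan : ∀ ζ : ℂ, ζ ≠ 0 → AnalyticAt ℂ (fun z : Fin n → ℂ => L z / z N) (Pi.single N ζ) :=
    fun ζ hζ => (hLan _).div (hprojN _) (by simpa using hζ)
  have hB : ∀ᶠ z in 𝓝 (Pi.single N 1 : Fin n → ℂ), h N z - L z / z N = 0 := by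
    refine eventually_eq_zero_of_diag (lam := μ k / μ N) hμne (hμ1 N)
      (fun ζ hζ => (hhan N ζ hζ).sub (hgan ζ hζ)) (fun ζ hζ => ?_) (fun m s p hs hp => ?_)
    · filter_upwards [hWnhds ζ hζ] with z hz
      have e1 : L (fun i => μ i * z i) = μ k * L z := by
        simp only [hL, Finset.mul_sum]
        refine Finset.sum_congr rfl fun j _ => ?_
        by_cases hj : j ≠ N ∧ μ j = μ k
        · rw [hj.2]; ring
        · simp [hc, hj]
      rw [hhmul N z hz, e1, mul_sub, div_mul_div_comm (μ k) (μ N) (L z)]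
    · rcases hres m s hs p N k (hsmul hp) with ⟨-, -, -, h2⟩ | ⟨rfl, -, -, h2⟩
      · exact absurd (h2.1 rfl) hkN
      · have hd1 := (hhan N 1 one_ne_zero).differentiableAt
        have hd2 := (hgan 1 one_ne_zero).differentiableAt
        rw [iteratedFDeriv_one_apply, fderiv_fun_sub hd1 hd2, _root_.sub_apply, sub_eq_zero]
        have e1 : c (s 0) = fderiv ℂ (h N) (Pi.single N 1) (Pi.single (s 0) 1) :=
          if_pos ⟨hs 0, h2 0⟩
        rw [← e1, ← hd2.lineDeriv_eq_fderiv, lineDeriv]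
        have e2 : (fun t : ℂ => L ((Pi.single N 1 : Fin n → ℂ) + t • Pi.single (s 0) 1) /
            ((Pi.single N 1 : Fin n → ℂ) + t • (Pi.single (s 0) 1 : Fin n → ℂ)) N) =
            fun t => c (s 0) * t := by
          ext t
          have h3 : N ≠ s 0 := (hs 0).symm
          rw [hLadd, ← Pi.single_smul, hLsingle, hLsingle, hcN]
          simp [h3]
        rw [e2]
        simp
  have htwo : ∀ z ≠ 0, z N * Φ z N = L z * Φ z k := by
    intro z hz
    have := HasAnalyticLift.pairing_eq_zero hW (fun z hz => hΦ z hz)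
      (l := fun z => z N • Pi.single N 1 - L z • Pi.single k 1) (fun z _ =>
        ((hprojN z).smul analyticAt_const).sub ((hLan z).smul analyticAt_const))
      (z₀ := Pi.single N 1) (hax 1 one_ne_zero) (by
        have hN0 : ∀ᶠ z : Fin n → ℂ in 𝓝 (Pi.single N 1), z N ≠ 0 :=
          (hprojN _).continuousAt.eventually_ne (by simp)
        filter_upwards [hB, hΦk, hN0] with w hw hwk hwN
        have : w N * Φ w N = L w * Φ w k := by
          simp only [hh] at hw
          field_simp at hw
          linear_combination hw
        simp [sub_mul, Finset.sum_sub_distrib, Pi.single_apply, this]) z hz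
    simpa [sub_mul, Finset.sum_sub_distrib, Pi.single_apply, sub_eq_zero] using this
  -- nonsingularity away from the axis forces `L = 0`
  have hL0 : ∀ v, c v = 0 := by
    intro v
    by_contra hv
    have hvN : v ≠ N := fun h0 => hv (h0 ▸ hcN)
    -- A third index w exists since n ≥ 3, and p = c_v e_w - c_w e_v is killed by L.
    obtain ⟨p, hp0, hpN, hpL⟩ : ∃ p : Fin n → ℂ, p ≠ 0 ∧ p N = 0 ∧ L p = 0 := by
      obtain ⟨w, hw⟩ : ∃ w : Fin n, w ∉ ({N, v} : Finset (Fin n)) := by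
        by_contra! hcon
        have h1 := Finset.card_le_card (fun w (_ : w ∈ Finset.univ) => hcon w)
        rw [Finset.card_univ, Fintype.card_fin] at h1
        have h2 := Finset.card_le_two (a := N) (b := v)
        lia
      simp only [Finset.mem_insert, Finset.mem_singleton, not_or] at hw
      refine ⟨Pi.single w (c v) + Pi.single v (-c w), fun h0 => ?_, ?_, ?_⟩
      · have := congrFun h0 w
        simp [hw.2] at this
        exact hv this
      · simp [Ne.symm hw.1, Ne.symm hvN]
      · rw [hLadd, hLsingle, hLsingle]
        ring
    have hline : ∀ (v : Fin n) (i : Fin n), (∀ t : ℂ, t ≠ 0 → p + Pi.single v t ≠ 0 →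
        Φ (p + Pi.single v t) i = 0) → Φ p i = 0 := by
      intro v i hvi
      have hcont : Continuous fun t : ℂ => p + (Pi.single v t : Fin n → ℂ) :=
        continuous_const.add (continuous_single (A := fun _ : Fin n => ℂ) v)
      have h0 : p + (Pi.single v 0 : Fin n → ℂ) = p := by simp
      refine (hΦ p hp0).coord_eq_zero_of_frequently ?_
      have h1 : Tendsto (fun t : ℂ => p + (Pi.single v t : Fin n → ℂ)) (𝓝[≠] 0) (𝓝 p) := by
        have := hcont.tendsto 0
        rw [h0] at this
        exact this.mono_left nhdsWithin_le_nhds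
      refine h1.frequently (Eventually.frequently ?_)
      filter_upwards [self_mem_nhdsWithin, h1.eventually (eventually_ne_nhds hp0)] with t ht hpt
      exact hvi t ht hpt
    -- Along p + t e_v one has z_N = 0 and L = c_v t ≠ 0, so `htwo` gives Φₖ = 0. Along p + t e_N
    -- below, L = 0 and z_N = t ≠ 0, which gives Φ_N = 0. Both pass to the limit t → 0.
    have hpk : Φ p k = 0 := by
      refine hline v k fun t ht hpt => ?_
      have h1 := htwo _ hpt
      rw [hLadd, hpL, hLsingle] at h1
      simp only [Pi.add_apply, hpN, Pi.single_eq_of_ne hvN.symm, add_zero, zero_mul, zero_add] at h1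
      exact (mul_eq_zero.1 h1.symm).resolve_left (mul_ne_zero hv ht)
    have hpN' : Φ p N = 0 := by
      refine hline N N fun t ht hpt => ?_
      have h1 := htwo _ hpt
      rw [hLadd, hpL, hLsingle, hcN] at h1
      simp only [Pi.add_apply, hpN, Pi.single_eq_same, zero_mul, zero_add] at h1
      exact (mul_eq_zero.1 h1).resolve_left ht
    obtain ⟨i, hi⟩ := (hΦ p hp0).exists_ne_zero
    apply hi
    by_cases hiN : i = N
    · rw [hiN, hpN']
    · rw [hone i hiN p hp0, hpk, mul_zero]
  have hΦN : ∀ z ≠ 0, Φ z N = 0 := by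
    intro z hz
    have := HasAnalyticLift.pairing_eq_zero hW (fun z hz => hΦ z hz)
      (l := fun _ => Pi.single N 1) (fun z _ => analyticAt_const)
      (z₀ := Pi.single N 1) (hax 1 one_ne_zero) (by
        have hN0 : ∀ᶠ z : Fin n → ℂ in 𝓝 (Pi.single N 1), z N ≠ 0 :=
          (hprojN _).continuousAt.eventually_ne (by simp)
        filter_upwards [hWnhds 1 one_ne_zero, hN0] with w hw hwN
        have h1 := htwo w hw
        simp only [hL, hL0, zero_mul, Finset.sum_const_zero] at h1
        simpa [Pi.single_apply] using (mul_eq_zero.1 h1).resolve_left hwN) z hz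
    simpa [Pi.single_apply] using this
  refine ⟨Function.update q N 0, fun z hz => ?_⟩
  have hform : Φ z = Φ z k • Function.update q N 0 := by
    ext i
    by_cases hi : i = N
    · subst hi; simp [hΦN z hz]
    · simp [hi, mul_comm (Φ z k), ← hone i hi z hz]
  refine ⟨Φ z k, fun h0 => ?_, hform⟩
  obtain ⟨i, hi⟩ := (hΦ z hz).exists_ne_zero
  rw [hform, h0] at hi
  simp at hi

end Constancy

/-! ### Covectors annihilating a hyperplane -/

section Covector

variable {m : ℕ}

/-- The generalized cross product of `m` vectors in `ℂ^(m+1)`, as a covector. -/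
noncomputable def crossCovector (V : Fin m → Fin (m + 1) → ℂ) (j : Fin (m + 1)) : ℂ :=
  (-1) ^ (j : ℕ) * (Matrix.of fun i (l : Fin m) => V i (j.succAbove l)).det

lemma sum_crossCovector_mul (V : Fin m → Fin (m + 1) → ℂ) (v : Fin (m + 1) → ℂ) :
    ∑ j, crossCovector V j * v j =
      (Matrix.of (Fin.cons v V : Fin (m + 1) → Fin (m + 1) → ℂ)).det := by
  rw [Matrix.det_succ_row_zero]
  refine Finset.sum_congr rfl fun j _ => ?_
  have : (Matrix.of (Fin.cons v V : Fin (m + 1) → Fin (m + 1) → ℂ)).submatrix Fin.succ j.succAbove =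
      Matrix.of fun i (l : Fin m) => V i (j.succAbove l) := by
    ext i l
    simp
  rw [this]
  simp [crossCovector]
  ring

/-- The pairing is a determinant with first row v, which vanishes exactly when v depends on the
independent rows `V`. -/
lemma sum_crossCovector_mul_eq_zero_iff {V : Fin m → Fin (m + 1) → ℂ} (hV : LinearIndependent ℂ V)
    (v : Fin (m + 1) → ℂ) :
    ∑ j, crossCovector V j * v j = 0 ↔ v ∈ Submodule.span ℂ (range V) := by
  rw [sum_crossCovector_mul, ← not_iff_not, ← Ne, ← isUnit_iff_ne_zero,
    ← Matrix.isUnit_iff_isUnit_det, ← Matrix.linearIndependent_rows_iff_isUnit]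
  exact linearIndependent_finCons.trans (and_iff_right hV)

lemma crossCovector_ne_zero {V : Fin m → Fin (m + 1) → ℂ} (hV : LinearIndependent ℂ V) :
    crossCovector V ≠ 0 := by
  intro h
  have htop : Submodule.span ℂ (range V) = ⊤ := by
    refine eq_top_iff.2 fun v _ => (sum_crossCovector_mul_eq_zero_iff hV v).1 ?_
    simp [h]
  have h1 := finrank_span_eq_card hV
  rw [htop, finrank_top, Module.finrank_fin_fun, Fintype.card_fin] at h1
  lia

lemma analyticAt_crossCovector {E : Type*} [NormedAddCommGroup E] [NormedSpace ℂ E]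
    {V : Fin m → E → Fin (m + 1) → ℂ} {z : E} (hV : ∀ i, AnalyticAt ℂ (V i) z) :
    AnalyticAt ℂ (fun w => crossCovector fun i => V i w) z := by
  refine analyticAt_pi_iff.2 fun j => ?_
  simp only [crossCovector, Matrix.det_apply', Matrix.of_apply]
  refine analyticAt_const.mul (Finset.analyticAt_fun_sum _ fun σ _ => ?_)
  refine analyticAt_const.mul (Finset.analyticAt_fun_prod _ fun l _ => ?_)
  exact (analyticAt_pi_iff.1 (hV _)) _

/-- Covectors with the same kernel are proportional. -/
lemma exists_smul_eq_of_ker_eq {ι : Type*} [Fintype ι] [DecidableEq ι] {φ η : ι → ℂ} (hφ : φ ≠ 0)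
    (hη : η ≠ 0) (h : ∀ v : ι → ℂ, ∑ i, η i * v i = 0 → ∑ i, φ i * v i = 0) :
    ∃ c : ℂ, c ≠ 0 ∧ φ = c • η := by
  obtain ⟨k, hk⟩ := Function.ne_iff.1 hη
  have hk' : η k ≠ 0 := hk
  have hform : φ = (φ k / η k) • η := by
    ext i
    have h1 := h (Pi.single i 1 - (η i / η k) • Pi.single k 1) (by
      simp [mul_sub, Finset.sum_sub_distrib, Pi.single_apply]
      field_simp
      ring)
    simp [mul_sub, Finset.sum_sub_distrib, Pi.single_apply] at h1
    rw [Pi.smul_apply, smul_eq_mul]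
    linear_combination h1
  refine ⟨_, fun h0 => hφ ?_, hform⟩
  rw [hform, h0, zero_smul]

end Covector

lemma LinearEquiv.mem_span_range_symm_iff {E F κ : Type*} [AddCommGroup E] [Module ℂ E]
    [AddCommGroup F] [Module ℂ F] (T : E ≃ₗ[ℂ] F) (u : κ → F) (v : E) :
    v ∈ Submodule.span ℂ (range fun i => T.symm (u i)) ↔ T v ∈ Submodule.span ℂ (range u) := by
  have h : (range fun i => T.symm (u i)) = T.symm.toLinearMap '' range u := by
    rw [← Set.range_comp]
    rfl
  rw [h, Submodule.span_image]
  constructor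
  · rintro ⟨w, hw, rfl⟩
    simpa using hw
  · exact fun hv => ⟨T v, hv, T.symm_apply_apply v⟩

/-- In ℂⁿ the bracket is a difference of derivatives of `V` and `W`, and each of these lies in the
kernel of q. This is the closedness of a constant form. -/
lemma sum_mul_mlieBracket_eq_zero {n : ℕ} {q z : Fin n → ℂ} {V W : (Fin n → ℂ) → Fin n → ℂ}
    (hV : ∀ u, ∑ i, q i * fderiv ℂ V z u i = 0) (hW : ∀ u, ∑ i, q i * fderiv ℂ W z u i = 0) :
    ∑ i, q i * (VectorField.mlieBracket 𝓘(ℂ, Fin n → ℂ) V W z : Fin n → ℂ) i = 0 := by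
  have h : (VectorField.mlieBracket 𝓘(ℂ, Fin n → ℂ) V W z : Fin n → ℂ) =
      fderiv ℂ W z (V z) - fderiv ℂ V z (W z) := by
    exact (congrFun (VectorField.mlieBracketWithin_univ (I := 𝓘(ℂ, Fin n → ℂ)) (V := V)
      (W := W)).symm z).trans <| (congrFun VectorField.mlieBracketWithin_eq_lieBracketWithin z).trans
      (congrFun VectorField.lieBracketWithin_univ z)
  rw [h]
  simp only [Pi.sub_apply, mul_sub, Finset.sum_sub_distrib, hV, hW, sub_zero]

/-! ### Pull-back of distributions to the covering space -/

namespace HopfManifold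

variable {n : ℕ} (f : DiagonalContraction n)

open Classical in
/-- The projection `ℂⁿ \ {0} → X`, extended by a constant to `ℂⁿ`. -/
noncomputable def projExt (o : HopfManifold f) (z : Fin n → ℂ) : HopfManifold f :=
  if h : z ≠ 0 then proj f ⟨z, h⟩ else o

variable {f} (o : HopfManifold f)

lemma projExt_of_ne {z : Fin n → ℂ} (h : z ≠ 0) : projExt f o z = proj f ⟨z, h⟩ := dif_pos h

lemma projExt_eventuallyEq {i : Fin n} {a : ℝ} (ha : 0 < a) {z : Fin n → ℂ}
    (hz : z ∈ annulus f i a) : projExt f o =ᶠ[𝓝 z] (chart f i ha).symm := by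
  filter_upwards [(isOpen_annulus f i a).mem_nhds hz] with w hw
  rw [projExt_of_ne o (ne_zero_of_mem_annulus f ha hw), chart_symm_apply f i ha ⟨w, hw⟩]
  rfl

lemma chart_mem_atlas' (i : Fin n) {a : ℝ} (ha : 0 < a) :
    chart f i ha ∈ atlas (Fin n → ℂ) (HopfManifold f) :=
  mem_range_self (f := fun p : Fin n × {a : ℝ // 0 < a} => chart f p.1 p.2.2) (i, ⟨a, ha⟩)

lemma contMDiffAt_projExt {z : Fin n → ℂ} (hz : z ≠ 0) :
    ContMDiffAt 𝓘(ℂ, Fin n → ℂ) 𝓘(ℂ, Fin n → ℂ) ω (projExt f o) z := by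
  obtain ⟨i, a, ha, hza⟩ := exists_mem_annulus f hz
  refine ContMDiffAt.congr_of_eventuallyEq ?_ (projExt_eventuallyEq o ha hza)
  refine (contMDiffOn_symm_of_mem_maximalAtlas
    (IsManifold.subset_maximalAtlas (chart_mem_atlas' (f := f) i ha))).contMDiffAt ?_
  rw [chart_target]
  exact (isOpen_annulus f i a).mem_nhds hza

lemma mdifferentiableAt_projExt {z : Fin n → ℂ} (hz : z ≠ 0) :
    MDifferentiableAt 𝓘(ℂ, Fin n → ℂ) 𝓘(ℂ, Fin n → ℂ) (projExt f o) z :=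
  (contMDiffAt_projExt o hz).mdifferentiableAt (by simp)

lemma isInvertible_mfderiv_projExt {z : Fin n → ℂ} (hz : z ≠ 0) :
    (mfderiv 𝓘(ℂ, Fin n → ℂ) 𝓘(ℂ, Fin n → ℂ) (projExt f o) z).IsInvertible := by
  obtain ⟨i, a, ha, hza⟩ := exists_mem_annulus f hz
  have : IsManifold 𝓘(ℂ, Fin n → ℂ) 1 (HopfManifold f) := IsManifold.of_le (n := ω) le_top
  rw [(projExt_eventuallyEq o ha hza).mfderiv_eq]
  have hd := mdifferentiable_of_mem_atlas (I := 𝓘(ℂ, Fin n → ℂ)) (chart_mem_atlas' (f := f) i ha)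
  have hzt : z ∈ (chart f i ha).symm.source := by
    rw [OpenPartialHomeomorph.symm_source, chart_target]
    exact hza
  exact ⟨hd.symm.mfderiv hzt, rfl⟩

lemma projExt_mult {z : Fin n → ℂ} (hz : z ≠ 0) :
    projExt f o (fun i => f.mult i * z i) = projExt f o z := by
  have e : (fun i => f.mult i * z i) = f.iter 1 z := by
    funext i
    simp [DiagonalContraction.iter]
  rw [e, projExt_of_ne o hz, projExt_of_ne o (f.iter_ne_zero 1 hz)]
  exact ((proj_eq_iff f).2 ⟨1, rfl⟩).symm

/-- The pull-back of a distribution on the Hopf manifold to `ℂⁿ \ {0}`. -/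
noncomputable def pullbackFiber {k : ℕ} (D : HolomorphicDistribution (Fin n → ℂ) (HopfManifold f) k)
    (z : Fin n → ℂ) : Submodule ℂ (Fin n → ℂ) :=
  (D.fiber (projExt f o z)).comap
    (mfderiv 𝓘(ℂ, Fin n → ℂ) 𝓘(ℂ, Fin n → ℂ) (projExt f o) z).toLinearMap

variable {k : ℕ} (D : HolomorphicDistribution (Fin n → ℂ) (HopfManifold f) k)

lemma mem_pullbackFiber {z v : Fin n → ℂ} :
    v ∈ pullbackFiber o D z ↔
      mfderiv 𝓘(ℂ, Fin n → ℂ) 𝓘(ℂ, Fin n → ℂ) (projExt f o) z v ∈ D.fiber (projExt f o z) :=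
  Iff.rfl

lemma mem_fiber_congr {x y : HopfManifold f} (h : x = y) (v : Fin n → ℂ) :
    (show TangentSpace 𝓘(ℂ, Fin n → ℂ) x from v) ∈ D.fiber x ↔
      (show TangentSpace 𝓘(ℂ, Fin n → ℂ) y from v) ∈ D.fiber y := by
  subst h
  rfl

/-- Since π ∘ f = π, the chain rule gives dπ at fz composed with f equal to dπ at z, f being linear.
-/
lemma mem_pullbackFiber_mult {z : Fin n → ℂ} (hz : z ≠ 0) (v : Fin n → ℂ) :
    (fun i => f.mult i * v i) ∈ pullbackFiber o D (fun i => f.mult i * z i) ↔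
      v ∈ pullbackFiber o D z := by
  set T := diagEquiv f.mult f.mult_ne_zero with hT
  have hTz : ∀ z, T z = fun i => f.mult i * z i := diagEquiv_apply _ _
  have hTne : T z ≠ 0 := by simpa using hz
  have h1 : projExt f o ∘ T =ᶠ[𝓝 z] projExt f o := by
    filter_upwards [eventually_ne_nhds hz] with w hw
    rw [Function.comp_apply, hTz, projExt_mult o hw]
  have h2 := h1.mfderiv_eq (I := 𝓘(ℂ, Fin n → ℂ)) (I' := 𝓘(ℂ, Fin n → ℂ))
  have hTd : MDifferentiableAt 𝓘(ℂ, Fin n → ℂ) 𝓘(ℂ, Fin n → ℂ) T z :=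
    T.differentiableAt.mdifferentiableAt
  rw [mfderiv_comp z (mdifferentiableAt_projExt o hTne) hTd, mfderiv_eq_fderiv,
    T.fderiv] at h2
  rw [← hTz, ← hTz, mem_pullbackFiber, mem_pullbackFiber, ← h2]
  exact mem_fiber_congr D (by rw [hTz, projExt_mult o hz]) _

/-- The pull-back of a holomorphic distribution has local holomorphic frames. -/
lemma exists_frame_pullbackFiber {z : Fin n → ℂ} (hz : z ≠ 0) :
    ∃ V : Fin k → (Fin n → ℂ) → Fin n → ℂ, (∀ i, AnalyticAt ℂ (V i) z) ∧
      ∀ᶠ w in 𝓝 z, LinearIndependent ℂ (fun i => V i w) ∧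
        Submodule.span ℂ (range fun i => V i w) = pullbackFiber o D w := by
  obtain ⟨U, hU, hzU, V, hV, hfr⟩ := D.exists_frame (projExt f o z)
  have : IsManifold 𝓘(ℂ, Fin n → ℂ) 1 (HopfManifold f) := IsManifold.of_le (n := ω) le_top
  refine ⟨fun i => VectorField.mpullback 𝓘(ℂ, Fin n → ℂ) 𝓘(ℂ, Fin n → ℂ) (projExt f o) (V i),
    fun i => ?_, ?_⟩
  · have h1 : ContMDiffAt 𝓘(ℂ, Fin n → ℂ) 𝓘(ℂ, Fin n → ℂ).tangent ω
        (fun x => (⟨x, V i x⟩ : TangentBundle 𝓘(ℂ, Fin n → ℂ) (HopfManifold f)))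
        (projExt f o z) := (hV i).contMDiffAt (hU.mem_nhds hzU)
    have h2 := h1.mpullback_vectorField_preimage (contMDiffAt_projExt o hz)
      (isInvertible_mfderiv_projExt o hz) le_top
    exact (contMDiffAt_vectorSpace_iff_contDiffAt.1 h2).analyticAt
  · filter_upwards [eventually_ne_nhds hz,
      (contMDiffAt_projExt o hz).continuousAt.eventually (hU.mem_nhds hzU)] with w hw hwU
    obtain ⟨T, hT⟩ := isInvertible_mfderiv_projExt o hw
    obtain ⟨hli, hspan⟩ := hfr _ hwU
    have hinv : ∀ i, VectorField.mpullback 𝓘(ℂ, Fin n → ℂ) 𝓘(ℂ, Fin n → ℂ) (projExt f o) (V i) w =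
        T.symm (V i (projExt f o w)) := by
      intro i
      rw [VectorField.mpullback_apply, ← hT, ContinuousLinearMap.inverse_equiv]
      rfl
    simp only [hinv]
    refine ⟨hli.map' T.symm.toLinearEquiv.toLinearMap (LinearEquiv.ker _), ?_⟩
    ext v
    rw [mem_pullbackFiber, ← hspan, ← hT]
    exact T.toLinearEquiv.mem_span_range_symm_iff (fun i => V i (projExt f o w)) v

/-- A distribution whose pull-back to `ℂⁿ \ {0}` is the kernel of a constant form is integrable. -/
theorem isIntegrable_of_constant {q : Fin n → ℂ}
    (hq : ∀ z ≠ 0, ∀ v, v ∈ pullbackFiber o D z ↔ ∑ i, q i * v i = 0) : D.IsIntegrable := by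
  intro U hU V W hV hW hVD hWD x hx
  obtain ⟨⟨z, hz⟩, rfl⟩ := proj_surjective f x
  rw [← projExt_of_ne o hz] at hx ⊢
  have : IsManifold 𝓘(ℂ, Fin n → ℂ) 1 (HopfManifold f) := IsManifold.of_le (n := ω) le_top
  have : IsManifold 𝓘(ℂ, Fin n → ℂ) (minSmoothness ℂ 2) (HopfManifold f) :=
    IsManifold.of_le (n := ω) le_top
  have : IsManifold 𝓘(ℂ, Fin n → ℂ) (minSmoothness ℂ 2) (Fin n → ℂ) :=
    IsManifold.of_le (n := ω) le_top
  have hxU := hU.mem_nhds hx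
  have hpull : ∀ Y : ∀ x : HopfManifold f, TangentSpace 𝓘(ℂ, Fin n → ℂ) x,
      ∀ w, w ≠ 0 → mfderiv 𝓘(ℂ, Fin n → ℂ) 𝓘(ℂ, Fin n → ℂ) (projExt f o) w
        (VectorField.mpullback 𝓘(ℂ, Fin n → ℂ) 𝓘(ℂ, Fin n → ℂ) (projExt f o) Y w) =
          Y (projExt f o w) := by
    intro Y w hw
    rw [VectorField.mpullback_apply]
    exact (isInvertible_mfderiv_projExt o hw).self_apply_inverse _
  have key : ∀ Y : ∀ x : HopfManifold f, TangentSpace 𝓘(ℂ, Fin n → ℂ) x,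
      ContMDiffOn 𝓘(ℂ, Fin n → ℂ) 𝓘(ℂ, Fin n → ℂ).tangent ω
        (fun x => (⟨x, Y x⟩ : TangentBundle 𝓘(ℂ, Fin n → ℂ) (HopfManifold f))) U →
      (∀ x ∈ U, Y x ∈ D.fiber x) →
      ∀ u : Fin n → ℂ, ∑ i, q i * (fderiv ℂ (VectorField.mpullback 𝓘(ℂ, Fin n → ℂ)
        𝓘(ℂ, Fin n → ℂ) (projExt f o) Y : (Fin n → ℂ) → Fin n → ℂ) z u) i = 0 := by
    intro Y hY hYD u
    set Z : (Fin n → ℂ) → Fin n → ℂ :=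
      VectorField.mpullback 𝓘(ℂ, Fin n → ℂ) 𝓘(ℂ, Fin n → ℂ) (projExt f o) Y with hZ
    have h2 := (hY.contMDiffAt hxU).mpullback_vectorField_preimage (contMDiffAt_projExt o hz)
      (isInvertible_mfderiv_projExt o hz) (m := ω) le_top
    have h3 : DifferentiableAt ℂ Z z :=
      (contMDiffAt_vectorSpace_iff_contDiffAt.1 h2).differentiableAt (by simp)
    let Q : (Fin n → ℂ) →L[ℂ] ℂ := ∑ i, q i • ContinuousLinearMap.proj (R := ℂ)
      (φ := fun _ : Fin n => ℂ) i
    have hQ : ∀ v, Q v = ∑ i, q i * v i := fun v => by simp [Q]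
    -- The pulled-back field is tangent near z, so its pairing with the constant q vanishes
    -- identically there and may be differentiated.
    have h4 : (fun w => Q (Z w)) =ᶠ[𝓝 z] fun _ => 0 := by
      filter_upwards [eventually_ne_nhds hz,
        (contMDiffAt_projExt o hz).continuousAt.eventually hxU] with w hw hwU
      rw [hQ, ← hq w hw, mem_pullbackFiber]
      have := hYD _ hwU
      rw [← hpull Y w hw] at this
      exact this
    have h5 := h4.fderiv_eq (𝕜 := ℂ)
    have h6 : fderiv ℂ (fun w => Q (Z w)) z = Q.comp (fderiv ℂ Z z) :=
      (Q.hasFDerivAt.comp z h3.hasFDerivAt).fderiv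
    rw [h6] at h5
    have h7 := congrArg (fun T : (Fin n → ℂ) →L[ℂ] ℂ => T u) h5
    simpa [hQ] using h7
  have hmd : ∀ Y : ∀ x : HopfManifold f, TangentSpace 𝓘(ℂ, Fin n → ℂ) x,
      ContMDiffOn 𝓘(ℂ, Fin n → ℂ) 𝓘(ℂ, Fin n → ℂ).tangent ω
        (fun x => (⟨x, Y x⟩ : TangentBundle 𝓘(ℂ, Fin n → ℂ) (HopfManifold f))) U →
      MDifferentiableAt 𝓘(ℂ, Fin n → ℂ) 𝓘(ℂ, Fin n → ℂ).tangent
        (fun x => (⟨x, Y x⟩ : TangentBundle 𝓘(ℂ, Fin n → ℂ) (HopfManifold f)))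
        (projExt f o z) := fun Y hY => (hY.contMDiffAt hxU).mdifferentiableAt (by simp)
  -- Pull-back commutes with brackets, so tangency can be tested on ℂⁿ.
  have hbr := VectorField.mpullback_mlieBracket (hmd V hV) (hmd W hW) (contMDiffAt_projExt o hz)
    le_top
  rw [← hpull (VectorField.mlieBracket 𝓘(ℂ, Fin n → ℂ) V W) z hz, hbr]
  refine (mem_pullbackFiber o D).1 ((hq z hz _).2 ?_)
  exact sum_mul_mlieBracket_eq_zero (key V hV hVD) (key W hW hWD)

end HopfManifold

/-! ### From constancy to integrability -/

namespace HopfManifold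

/-- A codimension one distribution is integrable if the contraction has only the resonances of a
generic or intermediary one. -/
theorem isIntegrable_of_resonance {m : ℕ} (hm : 3 ≤ m + 1) {f : DiagonalContraction (m + 1)}
    {N : Fin (m + 1)}
    (hres : ∀ (l : ℕ) (s : Fin l → Fin (m + 1)), (∀ a, s a ≠ N) → ∀ (p : ℤ) (i k : Fin (m + 1)),
      (∏ a, f.mult (s a)) * f.mult N ^ p * f.mult i = f.mult k →
      (l = 0 ∧ p = 0 ∧ f.mult i = f.mult k ∧ (i = N ↔ k = N)) ∨
        (l = 1 ∧ i = N ∧ k ≠ N ∧ ∀ a, f.mult (s a) = f.mult k))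
    (D : HolomorphicDistribution (Fin (m + 1) → ℂ) (HopfManifold f) m) : D.IsIntegrable := by
  let o : HopfManifold f := proj f ⟨fun _ => 1, fun h => one_ne_zero (congrFun h 0)⟩
  -- The annihilating covector is chosen pointwise with arbitrary scaling. Only its line matters,
  -- and `hlift` shows that this line has local analytic generators.
  have hex : ∀ z : Fin (m + 1) → ℂ, ∃ φ : Fin (m + 1) → ℂ, z ≠ 0 →
      φ ≠ 0 ∧ ∀ v, v ∈ pullbackFiber o D z ↔ ∑ i, φ i * v i = 0 := by
    intro z
    by_cases hz : z = 0
    · exact ⟨0, fun h => absurd hz h⟩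
    · obtain ⟨V, -, hV⟩ := exists_frame_pullbackFiber o D hz
      obtain ⟨hli, hspan⟩ := hV.self_of_nhds
      refine ⟨crossCovector fun i => V i z, fun _ => ⟨crossCovector_ne_zero hli, fun v => ?_⟩⟩
      rw [← hspan, sum_crossCovector_mul_eq_zero_iff hli]
  choose Φ hΦ using hex
  have hlift : ∀ z ≠ 0, HasAnalyticLift Φ z := by
    intro z hz
    obtain ⟨V, hVan, hV⟩ := exists_frame_pullbackFiber o D hz
    refine ⟨fun w => crossCovector fun i => V i w, analyticAt_crossCovector hVan,
      crossCovector_ne_zero hV.self_of_nhds.1, ?_⟩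
    filter_upwards [hV, eventually_ne_nhds hz] with w ⟨hli, hspan⟩ hw
    refine exists_smul_eq_of_ker_eq (hΦ w hw).1 (crossCovector_ne_zero hli) fun v hv => ?_
    rw [← (hΦ w hw).2, ← hspan]
    exact (sum_crossCovector_mul_eq_zero_iff hli v).1 hv
  have hequiv : ∀ z ≠ 0, ∃ c : ℂ, c ≠ 0 ∧
      ∀ i, f.mult i * Φ (fun i => f.mult i * z i) i = c * Φ z i := by
    intro z hz
    have hfz : (fun i => f.mult i * z i) ≠ 0 := by
      intro h0
      refine hz (funext fun i => ?_)
      exact (mul_eq_zero.1 (congrFun h0 i)).resolve_left (f.mult_ne_zero i)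
    have hne : (fun i => f.mult i * Φ (fun i => f.mult i * z i) i) ≠ 0 := by
      intro h0
      apply (hΦ _ hfz).1
      funext i
      exact (mul_eq_zero.1 (congrFun h0 i)).resolve_left (f.mult_ne_zero i)
    -- By invariance of the pull-back, the covector at fz transported by f annihilates the fibre at
    -- z, so it is proportional to Φ z.
    obtain ⟨c, hc, h⟩ := exists_smul_eq_of_ker_eq hne (hΦ z hz).1 fun v hv => by
      have h1 := ((hΦ _ hfz).2 _).1 ((mem_pullbackFiber_mult o D hz v).2 (((hΦ z hz).2 v).2 hv))
      rw [← h1]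
      exact Finset.sum_congr rfl fun i _ => by ring
    exact ⟨c, hc, fun i => congrFun h i⟩
  obtain ⟨q, hq⟩ := exists_constant_line hm f.norm_pos f.norm_lt_one hres hlift hequiv
  refine isIntegrable_of_constant o D (q := q) fun z hz v => ?_
  obtain ⟨b, hb, hbz⟩ := hq z hz
  rw [(hΦ z hz).2, hbz]
  simp only [Pi.smul_apply, smul_eq_mul, mul_assoc, ← Finset.mul_sum, mul_eq_zero, hb, false_or]

end HopfManifold

/-- Every nonsingular holomorphic distribution of codimension one on a generic or intermediary
Hopf manifold of dimension `n ≥ 3` is integrable. -/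
theorem mainTheorem3 (n : ℕ) (hn : 3 ≤ n) (f : DiagonalContraction n)
    (hf : f.IsGeneric ∨ f.IsIntermediary)
    (D : HolomorphicDistribution (Fin n → ℂ) (HopfManifold f) (n - 1)) :
    D.IsIntegrable := by
  obtain ⟨m, rfl⟩ : ∃ m, n = m + 1 := ⟨n - 1, by lia⟩
  obtain ⟨r, hr1, hr2, heq, hrel⟩ : ∃ r : ℕ, 1 ≤ r ∧ r ≤ m ∧
      (∀ i j : Fin (m + 1), i.val < r → j.val < r → f.mult i = f.mult j) ∧
      HasNoRelation f.mult (Finset.univ.filter fun i : Fin (m + 1) => i.val = 0 ∨ r ≤ i.val) := by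
    rcases hf with ⟨-, h⟩ | ⟨r, hr1, hr2, heq, hrel⟩
    -- The generic case is r = 1, where the representatives are all indices. In both cases r ≤ m, so
    -- the last index lies outside the block of equal multipliers.
    · refine ⟨1, le_rfl, by lia, fun i j hi hj => ?_, ?_⟩
      · rw [show i = j from Fin.ext (by lia)]
      · rwa [Finset.filter_true_of_mem fun i _ => by lia]
    · exact ⟨r, by lia, by lia, heq, hrel⟩
  exact HopfManifold.isIntegrable_of_resonance (N := Fin.last m) hn
    (fun l s hs p i k h => hrel.resonance hr1 hr2 f.mult_ne_zero heq s hs p i k h) D
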